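/- Let $b\ge 1$ and consider the full $b$-ary tree whose level $t$ has $b^t$ nodes. To every node $v$ assign a Clifford unitary $U_v$ on $b$ qubits, i.e. a unitary such that $U_vPU_v^\dagger$ is a Pauli operator for every Pauli operator $P$ (an element of $\{\eta P_1\otimes\cdots\otimes P_b:\ \eta\in\{\pm1,\pm i\},\ P_k\in\{I,\sigma_x,\sigma_y,\sigma_z\}\}$); the unitaries may differ from node to node. Let $V_v:\mathbb C^2\to(\mathbb C^2)^{\otimes b}$, $V_v|\psi\rangle=U_v(|\psi\rangle\otimes|0\rangle^{\otimes(b-1)})$, be the resulting encoders, let $W_t=\bigotimes_{v\text{ at level }t}V_v:(\mathbb C^2)^{\otimes b^t}\to(\mathbb C^2)^{\otimes b^{t+1}}$ (the $j$-th output qubit of $V_v$ being the qubit at the $j$-th child of $v$), and let $V_T=W_{T-1}\cdots W_1W_0$ be the depth-$T$ concatenated encoder, with $V_0=I$. For a single-qubit channel $\mathcal N$ let $$\mathcal E_0=\mathrm{id},\qquad \mathcal E_{t+1}(\rho)=\mathcal N^{\otimes b^{t+1}}\big(W_t\,\mathcal E_t(\rho)\,W_t^\dagger\big)$$ define the noisy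 tree channel $\mathcal E_T$. For $w\in\{x,y,z\}$ let $\mathcal D_w(\rho)=(\rho+\sigma_w\rho\sigma_w)/2$. The weight of a Pauli operator is the number of qubits on which it is not a multiple of the identity. The diamond norm of a superoperator $\Phi$ on a system $S$ is $\|\Phi\|_\diamond=\max_\rho\|(\Phi\otimes\mathrm{id}_R)(\rho)\|_1$, over the states $\rho$ of $S\otimes R$ with $\dim R=\dim S$, where $\|\cdot\|_1$ is the trace norm. Let $T\ge0$, $w\in\{x,y,z\}$, and let $L_w[T]$ be any Pauli operator on $b^T$ qubits that is a logical $\sigma_w$ operator, i.e. $L_w[T]\,V_T=V_T\,\sigma_w$. Then $$\big\|\mathcal E_T-\mathcal E_T\circ\mathcal D_w\big\|_\diamond^2\le 2\, r(T)\,\mathrm{weight}(L_w[T])$$ in each of the following two cases. (i) $\mathcal N$ is the depolarizing channel $\mathcal M_\epsilon(\rho)=(1-\epsilon)\rho+\epsilon\,\mathrm{Tr}(\rho)\,I/2$ with $0\le\epsilon\le1$, and $r(T)=(1-\epsilon)^T$. (ii) $w\in\{x,z\}$, $\mathcal N=\mathcal N_z\circ\mathcal N_x$ with $\mathcal N_u(\rho)=(1-p)\rho+p\,\sigma_u\rho\sigma_u$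 and $0\le p\le1$, $r(T)=(1-2p)^{2T}$, and there is a chain of Pauli operators $L_w[0],L_w[1],\dots,L_w[T]$ ending in the given $L_w[T]$, with $L_w[t]$ acting on $b^t$ qubits, such that $L_w[0]=\sigma_w$, no $L_w[t]$ acts as $\sigma_y$ on any qubit (each is, up to a phase in $\{\pm1,\pm i\}$, a tensor product of $I$, $\sigma_x$, $\sigma_z$), and $L_w[t+1]\,W_t=W_t\,L_w[t]$ for $0\le t<T$. -/

import Mathlib

open scoped Matrix ComplexOrder

noncomputable section

namespace QTree

/-! ### Pauli operators -/

/-- The four single-qubit Pauli labels. -/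
inductive Pauli where
  | I | X | Y | Z
  deriving DecidableEq

/-- The Pauli matrices. -/
def Pauli.matrix : Pauli → Matrix (Fin 2) (Fin 2) ℂ
  | .I => 1
  | .X => !![0, 1; 1, 0]
  | .Y => !![0, -Complex.I; Complex.I, 0]
  | .Z => !![1, 0; 0, -1]

/-- An element `phase • ⨂ i, string i` of the Pauli group on the qubits indexed by `ι`;
the phase is one of `1, -1, i, -i`. -/
structure PauliOp (ι : Type) where
  phase : ℂ
  phase_pow : phase ^ 4 = 1
  string : ι → Pauli

/-- The operator on the Hilbert space of the qubits `ι` (computational basis `ι → Fin 2`). -/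
def PauliOp.toMatrix {ι : Type} [Fintype ι] (P : PauliOp ι) :
    Matrix (ι → Fin 2) (ι → Fin 2) ℂ :=
  P.phase • Matrix.of fun x y => ∏ i, (P.string i).matrix (x i) (y i)

/-- The number of qubits on which the operator is not a multiple of the identity. -/
def PauliOp.weight {ι : Type} [Fintype ι] (P : PauliOp ι) : ℕ :=
  (Finset.univ.filter fun i => P.string i ≠ Pauli.I).card

/-- No qubit is acted on by `σ_y`. -/
def PauliOp.YFree {ι : Type} (P : PauliOp ι) : Prop :=
  ∀ i, P.string i ≠ Pauli.Y

/-- The operator `σ_w ⊗ ⋯ ⊗ σ_w`, with phase `1`. -/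
def PauliOp.const (ι : Type) (w : Pauli) : PauliOp ι :=
  ⟨1, one_pow 4, fun _ => w⟩

/-- `U` is a Clifford unitary: it conjugates Pauli operators to Pauli operators. -/
def IsClifford {ι : Type} [Fintype ι] [DecidableEq ι]
    (U : Matrix (ι → Fin 2) (ι → Fin 2) ℂ) : Prop :=
  U ∈ Matrix.unitaryGroup (ι → Fin 2) ℂ ∧
    ∀ P : PauliOp ι, ∃ Q : PauliOp ι, U * P.toMatrix * Uᴴ = Q.toMatrix

/-! ### Superoperators -/

/-- Linear maps from operators on `ℂ^n` to operators on `ℂ^m`. -/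
abbrev SuperOp (n m : Type) := Matrix n n ℂ →ₗ[ℂ] Matrix m m ℂ

/-- `ρ ↦ A ρ A†`. -/
def conjBy {n m : Type} [Fintype n] (A : Matrix m n ℂ) : SuperOp n m where
  toFun ρ := A * ρ * Aᴴ
  map_add' ρ τ := by rw [Matrix.mul_add, Matrix.add_mul]
  map_smul' c ρ := by simp

/-- The tensor power `Φ^{⊗ι}` of a single-qubit superoperator: the linear map with
`⨂ i, |x i⟩⟨y i| ↦ ⨂ i, Φ(|x i⟩⟨y i|)`. -/
def tensorPower (ι : Type) [Fintype ι] [DecidableEq ι] (Φ : SuperOp (Fin 2) (Fin 2)) :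
    SuperOp (ι → Fin 2) (ι → Fin 2) where
  toFun ρ := Matrix.of fun a c => ∑ x : ι → Fin 2, ∑ y : ι → Fin 2,
    ρ x y * ∏ i, Φ (Matrix.single (x i) (y i) 1) (a i) (c i)
  map_add' ρ τ := by
    ext a c
    simp [add_mul, Finset.sum_add_distrib]
  map_smul' r ρ := by
    ext a c
    simp [mul_assoc, Finset.mul_sum]

/-- `Φ ⊗ id_R` for a reference system `R`: `Φ` is applied to each block `⟨i|_R ρ |j⟩_R`. -/
def ampliate {n m : Type} (r : Type) (Φ : SuperOp n m) (ρ : Matrix (n × r) (n × r) ℂ) :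
    Matrix (m × r) (m × r) ℂ :=
  Matrix.of fun p q => Φ (Matrix.of fun x y => ρ (x, p.2) (y, q.2)) p.1 q.1

/-- The trace norm `‖A‖₁`: the sum of the singular values, i.e. of the square roots of the
eigenvalues of `A† A`. -/
def traceNorm {n : Type} [Fintype n] [DecidableEq n] (A : Matrix n n ℂ) : ℝ :=
  ∑ i, Real.sqrt ((Matrix.isHermitian_conjTranspose_mul_self A).eigenvalues i)

/-- Density operators. -/
def IsState {n : Type} [Fintype n] (ρ : Matrix n n ℂ) : Prop :=
  ρ.PosSemidef ∧ ρ.trace = 1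

/-- The diamond norm `max_ρ ‖(Φ ⊗ id_R)(ρ)‖₁`, over all states `ρ` of the input system and a
reference system `R` of the same dimension. -/
def diamondNorm {n m : Type} [Fintype n] [Fintype m] [DecidableEq n] [DecidableEq m]
    (Φ : SuperOp n m) : ℝ :=
  sSup {c : ℝ | ∃ ρ : Matrix (n × n) (n × n) ℂ, IsState ρ ∧ c = traceNorm (ampliate n Φ ρ)}

theorem sum_eigenvalues_conjTranspose_mul_self {n : Type} [Fintype n] [DecidableEq n]
    (A : Matrix n n ℂ) :
    ∑ i, (Matrix.isHermitian_conjTranspose_mul_self A).eigenvalues i =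
      ∑ j, ∑ k, ‖A j k‖ ^ 2 := by
  have htr := (Matrix.isHermitian_conjTranspose_mul_self A).trace_eq_sum_eigenvalues
  have h2 : (Aᴴ * A).trace = ((∑ j, ∑ k, ‖A j k‖ ^ 2 : ℝ) : ℂ) := by
    rw [Finset.sum_comm]
    simp [Matrix.trace, Matrix.mul_apply, Complex.conj_mul']
  have h3 := htr.symm.trans h2
  apply Complex.ofReal_injective
  rw [← h3]
  push_cast
  rfl

theorem traceNorm_le {n : Type} [Fintype n] [DecidableEq n] (A : Matrix n n ℂ) :
    traceNorm A ≤ ∑ _i : n, (1 + ∑ j, ∑ k, ‖A j k‖ ^ 2) := by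
  refine Finset.sum_le_sum fun i _ => ?_
  have h0 := (Matrix.posSemidef_conjTranspose_mul_self A).eigenvalues_nonneg
  have h1 := Finset.single_le_sum (fun i _ => h0 i) (Finset.mem_univ i)
  rw [sum_eigenvalues_conjTranspose_mul_self] at h1
  have h2 := Real.sq_sqrt (h0 i)
  nlinarith [sq_nonneg
    (Real.sqrt ((Matrix.isHermitian_conjTranspose_mul_self A).eigenvalues i) - 1), h0 i]

open scoped MatrixOrder Matrix.Norms.L2Operator in
theorem exists_eq_conjTranspose_mul_self {n : Type} [Fintype n] [DecidableEq n]
    {ρ : Matrix n n ℂ} (h : ρ.PosSemidef) : ∃ B : Matrix n n ℂ, ρ = Bᴴ * B :=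
  CStarAlgebra.nonneg_iff_eq_star_mul_self.mp h.nonneg

theorem IsState.norm_apply_le {n : Type} [Fintype n] {ρ : Matrix n n ℂ}
    (h : IsState ρ) (i j : n) : ‖ρ i j‖ ≤ 1 := by
  classical
  obtain ⟨B, rfl⟩ := exists_eq_conjTranspose_mul_self h.1
  have ht : ∑ k, ∑ l, ‖B l k‖ ^ 2 = 1 := by
    have h2 : (Bᴴ * B).trace = ((∑ k, ∑ l, ‖B l k‖ ^ 2 : ℝ) : ℂ) := by
      simp [Matrix.trace, Matrix.mul_apply, Complex.conj_mul']
    have h3 := h2.symm.trans h.2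
    exact_mod_cast h3
  have hc : ∀ k, ∑ l, ‖B l k‖ ^ 2 ≤ 1 := fun k => ht ▸
    Finset.single_le_sum (f := fun k => ∑ l, ‖B l k‖ ^ 2)
      (fun k _ => Finset.sum_nonneg fun l _ => sq_nonneg _) (Finset.mem_univ k)
  calc ‖(Bᴴ * B) i j‖ ≤ ∑ l, ‖B l i‖ * ‖B l j‖ := by
        rw [Matrix.mul_apply]
        refine (norm_sum_le _ _).trans (le_of_eq ?_)
        simp
    _ ≤ ∑ l, (‖B l i‖ ^ 2 + ‖B l j‖ ^ 2) / 2 :=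
        Finset.sum_le_sum fun l _ => by nlinarith [sq_nonneg (‖B l i‖ - ‖B l j‖)]
    _ ≤ 1 := by
        rw [← Finset.sum_div, Finset.sum_add_distrib]
        linarith [hc i, hc j]

/-- The supremum in the diamond norm is over a bounded set. -/
theorem diamondNorm_bddAbove {n m : Type} [Fintype n] [Fintype m] [DecidableEq n] [DecidableEq m]
    (Φ : SuperOp n m) :
    BddAbove {c : ℝ | ∃ ρ : Matrix (n × n) (n × n) ℂ,
      IsState ρ ∧ c = traceNorm (ampliate n Φ ρ)} := by
  refine ⟨∑ _i : m × n, (1 + ∑ p : m × n, ∑ q : m × n,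
    (∑ x, ∑ y, ‖Φ (Matrix.single x y 1) p.1 q.1‖) ^ 2), ?_⟩
  rintro c ⟨ρ, hρ, rfl⟩
  refine (traceNorm_le _).trans ?_
  gcongr with _ _ p _ q _
  have h : ampliate n Φ ρ p q =
      ∑ x, ∑ y, ρ (x, p.2) (y, q.2) * Φ (Matrix.single x y 1) p.1 q.1 := by
    have h2 : ∀ M : Matrix n n ℂ, Φ M p.1 q.1 =
        ∑ x, ∑ y, M x y * Φ (Matrix.single x y 1) p.1 q.1 := by
      intro M
      have h3 : ∀ x y, Matrix.single x y (M x y) = M x y • Matrix.single x y (1 : ℂ) := by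
        intro x y
        simp
      conv_lhs => rw [Matrix.matrix_eq_sum_single M]
      simp only [h3, map_sum, map_smul, Matrix.sum_apply, Matrix.smul_apply, smul_eq_mul]
    exact h2 _
  rw [h]
  refine (norm_sum_le _ _).trans (Finset.sum_le_sum fun x _ => ?_)
  refine (norm_sum_le _ _).trans (Finset.sum_le_sum fun y _ => ?_)
  rw [norm_mul]
  exact mul_le_of_le_one_left (norm_nonneg _) (hρ.norm_apply_le _ _)

/-! ### Single-qubit channels -/

/-- `N_w(ρ) = (1 - p) ρ + p σ_w ρ σ_w`. -/
def pauliFlip (w : Pauli) (p : ℝ) : SuperOp (Fin 2) (Fin 2) :=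
  ((1 - p : ℝ) : ℂ) • LinearMap.id + (p : ℂ) • conjBy w.matrix

/-- The depolarizing channel `M_ε(ρ) = (1 - ε) ρ + ε Tr(ρ) I / 2`. -/
def depolarizing (ε : ℝ) : SuperOp (Fin 2) (Fin 2) :=
  ((1 - ε : ℝ) : ℂ) • LinearMap.id +
    (ε : ℂ) • (Matrix.traceLinearMap (Fin 2) ℂ ℂ).smulRight ((1 / 2 : ℂ) • 1)

/-- The fully dephasing channel `D_w(ρ) = (ρ + σ_w ρ σ_w) / 2`. -/
def dephase (w : Pauli) : SuperOp (Fin 2) (Fin 2) :=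
  (1 / 2 : ℂ) • (LinearMap.id + conjBy w.matrix)

/-! ### The tree -/

/-- The nodes at level `t` of the full `b`-ary tree; there are `b ^ t` of them. The children of
`v` are `Fin.snoc v j` for `j : Fin b`. -/
abbrev Level (b t : ℕ) := Fin t → Fin b

/-- A choice of a unitary on `b` qubits for every node of the `b`-ary tree. -/
abbrev Unitaries (b : ℕ) := (t : ℕ) → Level b t → Matrix (Fin b → Fin 2) (Fin b → Fin 2) ℂ

/-- The encoder `V|ψ⟩ = U (|ψ⟩ ⊗ |0⟩^{⊗(b-1)})`; the data qubit is the qubit `0`. -/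
def encoder {b : ℕ} [NeZero b] (U : Matrix (Fin b → Fin 2) (Fin b → Fin 2) ℂ) :
    Matrix (Fin b → Fin 2) (Fin 2) ℂ :=
  Matrix.of fun x s => U x (Function.update (fun _ => 0) 0 s)

/-- The layer `⨂_v V_v`, over the nodes `v` at level `t`, where `V_v` is the encoder at `v`; it
maps the qubits at level `t` to those at level `t + 1`. -/
def layer {b : ℕ} [NeZero b] (U : Unitaries b) (t : ℕ) :
    Matrix (Level b (t + 1) → Fin 2) (Level b t → Fin 2) ℂ :=
  Matrix.of fun x y => ∏ v : Level b t,
    encoder (U t v) (fun j => x (Fin.snoc (α := fun _ => Fin b) v j)) (y v)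

/-- The identification of `ℂ²` with the space of the single qubit at the root. -/
def rootIso (b : ℕ) : Matrix (Level b 0 → Fin 2) (Fin 2) ℂ :=
  Matrix.of fun x s => if x Fin.elim0 = s then 1 else 0

/-- The noiseless concatenated encoder `V_T`, with one encoder per node. -/
def concatEncoder {b : ℕ} [NeZero b] (U : Unitaries b) :
    (T : ℕ) → Matrix (Level b T → Fin 2) (Fin 2) ℂ
  | 0 => rootIso b
  | T + 1 => layer U T * concatEncoder U T

/-- The noisy tree channel `E_T`: each layer of encoders is followed by the noise `N` on each of
its output qubits. -/
def treeChannel {b : ℕ} [NeZero b] (U : Unitaries b) (N : SuperOp (Fin 2) (Fin 2)) :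
    (T : ℕ) → SuperOp (Fin 2) (Level b T → Fin 2)
  | 0 => conjBy (rootIso b)
  | T + 1 => tensorPower (Level b (T + 1)) N ∘ₗ conjBy (layer U T) ∘ₗ treeChannel U N T

/-- `L` is a logical `σ_w` operator of the concatenated encoder: `L V_T = V_T σ_w`. -/
def IsLogical {b : ℕ} [NeZero b] (U : Unitaries b) (T : ℕ) (w : Pauli)
    (L : PauliOp (Level b T)) : Prop :=
  L.toMatrix * concatEncoder U T = concatEncoder U T * w.matrix

/-- `L` is the last term of a chain `L_w[0] = σ_w → L_w[1] → ⋯ → L_w[T] = L` of `σ_y`-free Pauli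
operators, `L_w[t]` acting on the qubits at level `t`, such that each layer of encoders maps
`L_w[t]` to `L_w[t+1]`. -/
def HasYFreeChain {b : ℕ} [NeZero b] (U : Unitaries b) (T : ℕ) (w : Pauli)
    (L : PauliOp (Level b T)) : Prop :=
  ∃ C : (t : ℕ) → PauliOp (Level b t),
    C 0 = PauliOp.const (Level b 0) w ∧ C T = L ∧
    (∀ t ≤ T, (C t).YFree) ∧
    ∀ t < T, (C (t + 1)).toMatrix * layer U t = layer U t * (C t).toMatrix

end QTree

end

open QTree

/-! The quantum statement reduces to classical broadcasting of a bit on the tree. Up to phase, a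
logical operator is a family of Pauli letters on the nodes, each encoder turning the letter at a
node into the letters at its children. Both noises are products of independent flips along the Pauli
axes (`depolarizing_eq_axisFlips`), and conjugations by Paulis commute. So at a node with letter `a`
the flip along `a` can be split off, and the remaining noise passes through every Pauli. Pushing
`σ_w ^ x` from the input to the leaves, the exponent is copied to all children by each encoder and
passed through a binary symmetric channel by each flip. In the end (`HasChain.exists_broadcast`) the
tree channel after conjugation by `σ_w ^ x` is a mixture, with weights `P x y`, of Pauli
conjugations indexed by leaf bits `y`, composed with a channel that does not depend on `x`.

Since `D_w` averages over `x`, the diamond distance is at most the total variation distance of `P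
false` and `P true`, whose square is at most their `χ²`-information. This information is subadditive
over independent symmetric observations (`SymKernel.chi_mul_le`) and shrinks by exactly `(1 - 2q)²`
through a flip of rate `q` (`SymKernel.chi_noisy`). Recursion over the levels (`IsBroadcast.step`)
bounds it by `c ^ T` times the number of leaves with a nontrivial letter, which is the weight.

In case (ii) the letters come with the given chain. In case (i) the Clifford property produces them
(`hasChain_of_isLogical`): at each node a Pauli string acts as a Pauli on the data qubit or sends
the code space to its orthogonal complement, and a logical operator excludes the latter. -/

noncomputable section

namespace QTree

/-! ### The trace norm of a difference of positive operators -/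

section TraceNorm

variable {n : Type} [Fintype n] [DecidableEq n]

/-- With `P = BᴴB`, the traces of `(BZ ± B)(BZ ± B)ᴴ` are nonnegative, and `ZZᴴ ≤ 1` bounds their
quadratic term by `tr P`. -/
theorem abs_re_trace_mul_le {P Z : Matrix n n ℂ} (hP : P.PosSemidef)
    (hZ : (1 - Z * Zᴴ).PosSemidef) : |(Z * P).trace.re| ≤ P.trace.re := by
  obtain ⟨B, rfl⟩ := exists_eq_conjTranspose_mul_self hP
  have h1 : 0 ≤ (B * (1 - Z * Zᴴ) * Bᴴ).trace :=
    (hZ.mul_mul_conjTranspose_same B).trace_nonneg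
  have h2 : 0 ≤ ((B * Z - B) * (B * Z - B)ᴴ).trace :=
    (Matrix.posSemidef_self_mul_conjTranspose _).trace_nonneg
  have h3 : 0 ≤ ((B * Z + B) * (B * Z + B)ᴴ).trace :=
    (Matrix.posSemidef_self_mul_conjTranspose _).trace_nonneg
  have e1 : (Z * (Bᴴ * B)).trace = (B * Z * Bᴴ).trace := by
    rw [← mul_assoc, Matrix.trace_mul_comm, mul_assoc]
  have e2 : (Bᴴ * B).trace = (B * Bᴴ).trace := Matrix.trace_mul_comm _ _
  have e3 : (B * Zᴴ * Bᴴ).trace = star (B * Z * Bᴴ).trace := by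
    rw [← Matrix.trace_conjTranspose]
    simp [Matrix.conjTranspose_mul, mul_assoc]
  have h1' := (Complex.le_def.1 h1).1
  have h2' := (Complex.le_def.1 h2).1
  have h3' := (Complex.le_def.1 h3).1
  simp only [Matrix.conjTranspose_sub, Matrix.conjTranspose_add, Matrix.conjTranspose_mul, mul_sub,
    sub_mul, mul_add, add_mul, mul_one, Matrix.trace_sub, Matrix.trace_add, ← mul_assoc, e3,
    Complex.zero_re, Complex.sub_re, Complex.add_re, Complex.star_def, Complex.conj_re]
    at h1' h2' h3'
  rw [e1, e2, abs_le]
  constructor <;> linarith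

/-- Polar decomposition: `Z = |A|⁻¹ Aᴴ` is a contraction with `ZA = |A|`, so the trace norm is `Re
tr(ZP) - Re tr(ZQ)`. -/
theorem traceNorm_sub_le {P Q : Matrix n n ℂ} (hP : P.PosSemidef) (hQ : Q.PosSemidef) :
    traceNorm (P - Q) ≤ P.trace.re + Q.trace.re := by
  set A := P - Q with hA
  set H := Matrix.isHermitian_conjTranspose_mul_self A
  have hl : ∀ i, 0 ≤ H.eigenvalues i := (Matrix.posSemidef_conjTranspose_mul_self A).eigenvalues_nonneg
  set V : Matrix n n ℂ := (H.eigenvectorUnitary : Matrix n n ℂ)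
  have hV : Vᴴ * V = 1 := Matrix.UnitaryGroup.star_mul_self H.eigenvectorUnitary
  have hV' : V * Vᴴ = 1 := (Matrix.mem_unitaryGroup_iff).1 H.eigenvectorUnitary.2
  set s : n → ℝ := fun i => Real.sqrt (H.eigenvalues i) with hs
  have hss : ∀ i, s i * s i = H.eigenvalues i := fun i => Real.mul_self_sqrt (hl i)
  have hspec : Aᴴ * A = V * Matrix.diagonal (fun i => (H.eigenvalues i : ℂ)) * Vᴴ := by
    have := H.spectral_theorem
    rw [Unitary.conjStarAlgAut_apply] at this
    exact this
  -- As `0⁻¹ = 0`, this is the pseudo-inverse of `|A|` in its eigenbasis, and `Z * Zᴴ` becomes a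
  -- projection even when `A` is singular.
  set D : Matrix n n ℂ := Matrix.diagonal fun i => ((s i)⁻¹ : ℂ) with hD
  set Z := V * D * Vᴴ * Aᴴ with hZ
  have hDD : Dᴴ = D := by
    rw [hD, Matrix.diagonal_conjTranspose]
    congr 1
    ext i
    simp
  have hVc : ∀ M : Matrix n n ℂ, Vᴴ * (V * M) = M := fun M => by rw [← mul_assoc, hV, one_mul]
  have h1 : Z * A = V * Matrix.diagonal (fun i => (s i : ℂ)) * Vᴴ := by
    have : D * Matrix.diagonal (fun i => (H.eigenvalues i : ℂ)) =
        Matrix.diagonal (fun i => (s i : ℂ)) := by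
      rw [hD, Matrix.diagonal_mul_diagonal]
      congr 1
      ext i
      rw [← hss]
      by_cases h0 : s i = 0
      · simp [h0]
      · have : (s i : ℂ) ≠ 0 := by exact_mod_cast h0
        push_cast
        field_simp
    rw [hZ, mul_assoc, hspec, ← this]
    simp only [mul_assoc, hVc]
  have h2 : Z * Zᴴ = V * Matrix.diagonal (fun i => if s i = 0 then (0 : ℂ) else 1) * Vᴴ := by
    have : D * Matrix.diagonal (fun i => (H.eigenvalues i : ℂ)) * D =
        Matrix.diagonal (fun i => if s i = 0 then (0 : ℂ) else 1) := by
      rw [hD, Matrix.diagonal_mul_diagonal, Matrix.diagonal_mul_diagonal]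
      congr 1
      ext i
      rw [← hss]
      by_cases h0 : s i = 0
      · simp [h0]
      · have : (s i : ℂ) ≠ 0 := by exact_mod_cast h0
        push_cast
        rw [if_neg h0]
        field_simp
    have e : Zᴴ = A * (V * (D * Vᴴ)) := by
      simp [hZ, Matrix.conjTranspose_mul, hDD, mul_assoc]
    rw [e, hZ, mul_assoc (V * D * Vᴴ), ← mul_assoc Aᴴ, hspec, ← this]
    simp only [mul_assoc, hVc]
  have h3 : (1 - Z * Zᴴ).PosSemidef := by
    have e : 1 - Z * Zᴴ = V * Matrix.diagonal (fun i => if s i = 0 then (1 : ℂ) else 0) * Vᴴ := by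
      rw [h2, ← hV']
      have : Matrix.diagonal (fun i => if s i = 0 then (1 : ℂ) else 0) =
          1 - Matrix.diagonal (fun i => if s i = 0 then (0 : ℂ) else 1) := by
        rw [← Matrix.diagonal_one, Matrix.diagonal_sub]
        congr 1
        ext i
        split_ifs <;> simp
      rw [this, mul_sub, sub_mul, mul_one]
    rw [e]
    refine Matrix.PosSemidef.mul_mul_conjTranspose_same (Matrix.PosSemidef.diagonal ?_) V
    intro i
    dsimp
    split_ifs <;> simp
  have h4 : traceNorm A = (Z * A).trace.re := by
    rw [h1, Matrix.trace_mul_comm, hVc, Matrix.trace_diagonal, Complex.re_sum]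
    rfl
  rw [h4, hA, mul_sub, Matrix.trace_sub, Complex.sub_re]
  have hp := abs_le.1 (abs_re_trace_mul_le hP h3)
  have hq := abs_le.1 (abs_re_trace_mul_le hQ h3)
  linarith

theorem traceNorm_sum_smul_le {κ : Type} [Fintype κ] (c : κ → ℝ) (S : κ → Matrix n n ℂ)
    (hS : ∀ k, (S k).PosSemidef) (ht : ∀ k, (S k).trace = 1) :
    traceNorm (∑ k, (c k : ℂ) • S k) ≤ ∑ k, |c k| := by
  have e : ∑ k, (c k : ℂ) • S k =
      ∑ k, ((max (c k) 0 : ℝ) : ℂ) • S k - ∑ k, ((max (-c k) 0 : ℝ) : ℂ) • S k := by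
    rw [← Finset.sum_sub_distrib]
    refine Finset.sum_congr rfl fun k _ => ?_
    rw [← sub_smul, ← Complex.ofReal_sub]
    congr 2
    rcases le_total (c k) 0 with h | h
    · rw [max_eq_right h, max_eq_left (by linarith)]; ring
    · rw [max_eq_left h, max_eq_right (by linarith)]; ring
  have hpos : ∀ d : κ → ℝ, (∀ k, 0 ≤ d k) → (∑ k, (d k : ℂ) • S k).PosSemidef := fun d hd =>
    Matrix.posSemidef_sum _ fun k _ => (hS k).smul (by exact_mod_cast hd k)
  have htr : ∀ d : κ → ℝ, (∑ k, (d k : ℂ) • S k).trace.re = ∑ k, d k := fun d => by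
    rw [Matrix.trace_sum, Complex.re_sum]
    simp [Matrix.trace_smul, ht]
  rw [e]
  refine (traceNorm_sub_le (hpos _ fun k => le_max_right _ _)
    (hpos _ fun k => le_max_right _ _)).trans (le_of_eq ?_)
  rw [htr, htr, ← Finset.sum_add_distrib]
  refine Finset.sum_congr rfl fun k _ => ?_
  rcases le_total (c k) 0 with h | h
  · rw [max_eq_right h, max_eq_left (by linarith), abs_of_nonpos h]; ring
  · rw [max_eq_left h, max_eq_right (by linarith), abs_of_nonneg h]; ring

end TraceNorm

/-! ### Conjugations -/

section Conj

variable {n m l : Type} [Fintype n]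

theorem conjBy_apply (A : Matrix m n ℂ) (ρ : Matrix n n ℂ) : conjBy A ρ = A * ρ * Aᴴ := rfl

theorem conjBy_comp [Fintype m] (A : Matrix l m ℂ) (B : Matrix m n ℂ) :
    conjBy A ∘ₗ conjBy B = conjBy (A * B) := by
  ext1 ρ
  simp [conjBy_apply, Matrix.mul_assoc, Matrix.conjTranspose_mul]

theorem conjBy_smul {c : ℂ} (hc : ‖c‖ = 1) (A : Matrix m n ℂ) : conjBy (c • A) = conjBy A := by
  ext1 ρ
  have : c * star c = 1 := by
    rw [Complex.star_def, Complex.mul_conj, Complex.normSq_eq_norm_sq, hc]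
    simp
  simp only [conjBy_apply, Matrix.conjTranspose_smul, Matrix.smul_mul, Matrix.mul_smul, smul_smul]
  rw [mul_comm, this, one_smul]

theorem conjBy_one [DecidableEq n] : conjBy (1 : Matrix n n ℂ) = LinearMap.id := by
  ext1 ρ
  simp [conjBy_apply]

end Conj

/-! ### Channels -/

/-- Completely positive trace preserving maps. -/
def IsChannel {n m : Type} [Fintype n] [Fintype m] (Φ : SuperOp n m) : Prop :=
  (∀ (r : Type) [Fintype r] (ρ : Matrix (n × r) (n × r) ℂ), ρ.PosSemidef →
    (ampliate r Φ ρ).PosSemidef) ∧ ∀ ρ, (Φ ρ).trace = ρ.trace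

section Channel

variable {n m l : Type} [Fintype n] [Fintype m] [Fintype l]

theorem IsChannel.comp {Φ : SuperOp m l} {Ψ : SuperOp n m} (hΦ : IsChannel Φ)
    (hΨ : IsChannel Ψ) : IsChannel (Φ ∘ₗ Ψ) :=
  ⟨fun r _ ρ hρ => hΦ.1 r _ (hΨ.1 r ρ hρ), fun ρ => (hΦ.2 _).trans (hΨ.2 ρ)⟩

theorem IsChannel.trace_ampliate {Φ : SuperOp n m} (hΦ : IsChannel Φ) (r : Type) [Fintype r]
    (ρ : Matrix (n × r) (n × r) ℂ) : (ampliate r Φ ρ).trace = ρ.trace := by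
  simp only [Matrix.trace, Matrix.diag, Fintype.sum_prod_type_right]
  exact Finset.sum_congr rfl fun j _ => hΦ.2 (Matrix.of fun x y => ρ (x, j) (y, j))

theorem isChannel_conjBy [DecidableEq n] {A : Matrix m n ℂ} (hA : Aᴴ * A = 1) :
    IsChannel (conjBy A) := by
  constructor
  · intro r _ ρ hρ
    classical
    have e : ampliate r (conjBy A) ρ =
        Matrix.kronecker A (1 : Matrix r r ℂ) * ρ * (Matrix.kronecker A (1 : Matrix r r ℂ))ᴴ := by
      ext ⟨a, i⟩ ⟨c, j⟩
      simp [ampliate, conjBy, Matrix.mul_apply, Matrix.kroneckerMap_apply, Fintype.sum_prod_type,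
        Matrix.one_apply, apply_ite]
    rw [e]
    exact hρ.mul_mul_conjTranspose_same _
  · intro ρ
    change (A * ρ * Aᴴ).trace = _
    rw [Matrix.trace_mul_comm, ← Matrix.mul_assoc, hA, Matrix.one_mul]

theorem IsChannel.sum_smul {κ : Type} [Fintype κ] {c : κ → ℝ} (hc : ∀ k, 0 ≤ c k)
    (hc1 : ∑ k, c k = 1) {Φ : κ → SuperOp n m} (hΦ : ∀ k, IsChannel (Φ k)) :
    IsChannel (∑ k, (c k : ℂ) • Φ k) := by
  constructor
  · intro r _ ρ hρ
    have e : ampliate r (∑ k, (c k : ℂ) • Φ k) ρ = ∑ k, (c k : ℂ) • ampliate r (Φ k) ρ := by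
      ext p q
      simp [ampliate, Matrix.sum_apply]
    rw [e]
    exact Matrix.posSemidef_sum _ fun k _ => ((hΦ k).1 r ρ hρ).smul (by exact_mod_cast hc k)
  · intro ρ
    have : ∑ k, (c k : ℂ) = 1 := by exact_mod_cast hc1
    simp [Matrix.trace_sum, Matrix.trace_smul, (hΦ _).2, ← Finset.sum_mul, this]

theorem diamondNorm_nonneg [DecidableEq n] [DecidableEq m] (Φ : SuperOp n m) :
    0 ≤ diamondNorm Φ := by
  refine Real.sSup_nonneg ?_
  rintro _ ⟨ρ, -, rfl⟩
  exact Finset.sum_nonneg fun i _ => Real.sqrt_nonneg _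

theorem diamondNorm_sum_smul_le [DecidableEq n] [DecidableEq m] {κ : Type} [Fintype κ]
    (c : κ → ℝ) {Φ : κ → SuperOp n m} (hΦ : ∀ k, IsChannel (Φ k)) :
    diamondNorm (∑ k, (c k : ℂ) • Φ k) ≤ ∑ k, |c k| := by
  refine Real.sSup_le ?_ (Finset.sum_nonneg fun _ _ => abs_nonneg _)
  rintro _ ⟨ρ, hρ, rfl⟩
  have e : ampliate n (∑ k, (c k : ℂ) • Φ k) ρ = ∑ k, (c k : ℂ) • ampliate n (Φ k) ρ := by
    ext p q
    simp [ampliate, Matrix.sum_apply]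
  rw [e]
  exact traceNorm_sum_smul_le c _ (fun k => (hΦ k).1 n ρ hρ.1)
    fun k => ((hΦ k).trace_ampliate n ρ).trans hρ.2

end Channel

/-! ### Symmetric binary-input kernels and broadcasting -/

/-- A binary-input channel with outputs in `Ω` and an involution of `Ω` exchanging the output
distributions of the two inputs. -/
structure SymKernel (Ω : Type) [Fintype Ω] where
  prob : Bool → Ω → ℝ
  nonneg : ∀ x ω, 0 ≤ prob x ω
  sum_eq_one : ∀ x, ∑ ω, prob x ω = 1
  flip : Ω → Ω
  flip_flip : Function.Involutive flip
  prob_flip : ∀ x ω, prob (!x) (flip ω) = prob x ω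

/-- The `χ²`-information of a binary-input channel with uniform input. -/
def chi {Ω : Type} [Fintype Ω] (k : Bool → Ω → ℝ) : ℝ :=
  (∑ ω, (k false ω - k true ω) ^ 2 / (k false ω + k true ω)) / 2

theorem chi_nonneg {Ω : Type} [Fintype Ω] {k : Bool → Ω → ℝ} (hk : ∀ x ω, 0 ≤ k x ω) :
    0 ≤ chi k :=
  div_nonneg (Finset.sum_nonneg fun _ _ =>
    div_nonneg (sq_nonneg _) (add_nonneg (hk _ _) (hk _ _))) two_pos.le

theorem chi_congr_equiv {Ω Ω' : Type} [Fintype Ω] [Fintype Ω'] (e : Ω ≃ Ω')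
    (k : Bool → Ω' → ℝ) : chi (fun x ω => k x (e ω)) = chi k := by
  unfold chi
  congr 1
  exact Fintype.sum_equiv e _ _ fun _ => rfl

/-- The total variation distance is at most the square root of the `χ²`-information. -/
theorem sq_sum_abs_sub_le_chi {Ω : Type} [Fintype Ω] {k : Bool → Ω → ℝ}
    (hk : ∀ x ω, 0 ≤ k x ω) (h1 : ∀ x, ∑ ω, k x ω = 1) :
    ((∑ ω, |k false ω - k true ω|) / 2) ^ 2 ≤ chi k := by
  -- Cauchy–Schwarz with weights `k false ω + k true ω`, whose total is 2. Where both probabilities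
  -- vanish, the quotient `0 / 0` is 0, as it should be.
  have hcs := Finset.sum_mul_sq_le_sq_mul_sq Finset.univ
    (fun ω => |k false ω - k true ω| / Real.sqrt (k false ω + k true ω))
    (fun ω => Real.sqrt (k false ω + k true ω))
  have e1 : ∀ ω, |k false ω - k true ω| / Real.sqrt (k false ω + k true ω) *
      Real.sqrt (k false ω + k true ω) = |k false ω - k true ω| := by
    intro ω
    have h0 := hk false ω
    have h0' := hk true ω
    rcases (add_nonneg h0 h0').eq_or_lt with h | h
    · have h2 : k false ω = 0 := by linarith
      have h3 : k true ω = 0 := by linarith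
      simp [h2, h3]
    · exact div_mul_cancel₀ _ (Real.sqrt_pos.2 h).ne'
  have e2 : ∀ ω, (|k false ω - k true ω| / Real.sqrt (k false ω + k true ω)) ^ 2 =
      (k false ω - k true ω) ^ 2 / (k false ω + k true ω) := fun ω => by
    rw [div_pow, sq_abs, Real.sq_sqrt (add_nonneg (hk _ _) (hk _ _))]
  have e3 : ∀ ω, Real.sqrt (k false ω + k true ω) ^ 2 = k false ω + k true ω := fun ω =>
    Real.sq_sqrt (add_nonneg (hk _ _) (hk _ _))
  simp only [e1, e2, e3] at hcs
  rw [Finset.sum_add_distrib, h1, h1] at hcs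
  unfold chi
  nlinarith

/-- Here `a`, `c` stand for sums and `b`, `d` for differences of the two output probabilities; the
two terms on the left belong to an outcome pair and to the pair with one outcome flipped. With `b =
ax` and `d = cy`, clearing denominators leaves `x²y²(2 - x² - y²) ≥ 0`. -/
theorem chi_two_mul_aux {a b c d : ℝ} (ha : |b| ≤ a) (hc : |d| ≤ c) :
    (a * d + b * c) ^ 2 / (2 * (a * c + b * d)) + (a * d - b * c) ^ 2 / (2 * (a * c - b * d)) ≤
      b ^ 2 / a * c + d ^ 2 / c * a := by
  rw [abs_le] at ha hc
  rcases (show 0 ≤ a by linarith).eq_or_lt with h | h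
  · have : b = 0 := by linarith
    simp [← h, this]
  rcases (show 0 ≤ c by linarith).eq_or_lt with h' | h'
  · have : d = 0 := by linarith
    simp [← h', this]
  obtain ⟨x, rfl⟩ : ∃ x, b = a * x := ⟨b / a, by field_simp⟩
  obtain ⟨y, rfl⟩ : ∃ y, d = c * y := ⟨d / c, by field_simp⟩
  have hx : -1 ≤ x ∧ x ≤ 1 := ⟨by nlinarith, by nlinarith⟩
  have hy : -1 ≤ y ∧ y ≤ 1 := ⟨by nlinarith, by nlinarith⟩
  have e1 : (a * (c * y) + a * x * c) ^ 2 / (2 * (a * c + a * x * (c * y))) =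
      a * c * ((x + y) ^ 2 / (2 * (1 + x * y))) := by
    rw [show (a * (c * y) + a * x * c) ^ 2 = (a * c) * ((a * c) * (x + y) ^ 2) by ring,
      show 2 * (a * c + a * x * (c * y)) = (a * c) * (2 * (1 + x * y)) by ring,
      mul_div_mul_left _ _ (mul_pos h h').ne', mul_div_assoc]
  have e2 : (a * (c * y) - a * x * c) ^ 2 / (2 * (a * c - a * x * (c * y))) =
      a * c * ((x - y) ^ 2 / (2 * (1 - x * y))) := by
    rw [show (a * (c * y) - a * x * c) ^ 2 = (a * c) * ((a * c) * (x - y) ^ 2) by ring,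
      show 2 * (a * c - a * x * (c * y)) = (a * c) * (2 * (1 - x * y)) by ring,
      mul_div_mul_left _ _ (mul_pos h h').ne', mul_div_assoc]
  have e3 : (a * x) ^ 2 / a * c + (c * y) ^ 2 / c * a = a * c * (x ^ 2 + y ^ 2) := by
    field_simp
  rw [e1, e2, e3, ← mul_add]
  refine mul_le_mul_of_nonneg_left ?_ (mul_pos h h').le
  have hx2 : x ^ 2 ≤ 1 := by nlinarith
  have hy2 : y ^ 2 ≤ 1 := by nlinarith
  have hxy : -1 ≤ x * y ∧ x * y ≤ 1 := by
    rw [← abs_le, ← sq_le_one_iff_abs_le_one, mul_pow]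
    exact mul_le_one₀ hx2 (sq_nonneg y) hy2
  have hsq : (x * y) ^ 2 = 1 → x ^ 2 = 1 ∧ y ^ 2 = 1 := fun h => by
    rw [mul_pow] at h
    have h1 := mul_le_mul_of_nonneg_left hy2 (sq_nonneg x)
    have h2 := mul_le_mul_of_nonneg_left hx2 (sq_nonneg y)
    constructor <;> linarith
  have ep : (x + y) ^ 2 = x ^ 2 + y ^ 2 + 2 * (x * y) := by ring
  have em : (x - y) ^ 2 = x ^ 2 + y ^ 2 - 2 * (x * y) := by ring
  rcases hxy.1.eq_or_lt with h1 | h1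
  -- One denominator is zero here; its term counts as 0 and the other term is 1, against a right
  -- side of 2.
  · obtain ⟨h3, h4⟩ := hsq (by rw [← h1]; norm_num)
    rw [ep, em, h3, h4, ← h1]
    norm_num
  rcases hxy.2.eq_or_lt with h2 | h2
  · obtain ⟨h3, h4⟩ := hsq (by rw [h2]; norm_num)
    rw [ep, em, h3, h4, h2]
    norm_num
  have p1 : 0 < 1 + x * y := by linarith
  have p2 : 0 < 1 - x * y := by linarith
  rw [div_add_div _ _ (by positivity) (by positivity), div_le_iff₀ (by positivity)]
  have : 0 ≤ x ^ 2 * y ^ 2 * (2 - x ^ 2 - y ^ 2) := by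
    have := mul_nonneg (sq_nonneg x) (sq_nonneg y)
    exact mul_nonneg this (by linarith)
  nlinarith

namespace SymKernel

variable {Ω Ω' : Type} [Fintype Ω] [Fintype Ω']

theorem prob_flip' (k : SymKernel Ω) (x : Bool) (ω : Ω) :
    k.prob x (k.flip ω) = k.prob (!x) ω := by
  rw [← k.prob_flip (!x), Bool.not_not]

theorem chi_mul_le (k : SymKernel Ω) (l : SymKernel Ω') :
    chi (fun x (ω : Ω × Ω') => k.prob x ω.1 * l.prob x ω.2) ≤ chi k.prob + chi l.prob := by
  set a := fun ω => k.prob false ω + k.prob true ω with ha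
  set b := fun ω => k.prob false ω - k.prob true ω with hb
  set c := fun ω => l.prob false ω + l.prob true ω with hc
  set d := fun ω => l.prob false ω - l.prob true ω with hd
  have hab : ∀ ω, |b ω| ≤ a ω := fun ω => by
    rw [abs_le]
    constructor <;> simp only [ha, hb] <;> linarith [k.nonneg false ω, k.nonneg true ω]
  have hcd : ∀ ω, |d ω| ≤ c ω := fun ω => by
    rw [abs_le]
    constructor <;> simp only [hc, hd] <;> linarith [l.nonneg false ω, l.nonneg true ω]
  have hsa : ∑ ω, a ω = 2 := by
    simp only [ha, Finset.sum_add_distrib, k.sum_eq_one]; norm_num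
  have hsc : ∑ ω, c ω = 2 := by
    simp only [hc, Finset.sum_add_distrib, l.sum_eq_one]; norm_num
  have e0 : ∑ ω : Ω × Ω', (k.prob false ω.1 * l.prob false ω.2 -
        k.prob true ω.1 * l.prob true ω.2) ^ 2 /
        (k.prob false ω.1 * l.prob false ω.2 + k.prob true ω.1 * l.prob true ω.2) =
      ∑ η, ∑ ω, (a ω * d η + b ω * c η) ^ 2 / (2 * (a ω * c η + b ω * d η)) := by
    rw [Fintype.sum_prod_type_right]
    refine Finset.sum_congr rfl fun η _ => Finset.sum_congr rfl fun ω _ => ?_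
    rw [show a ω * d η + b ω * c η = 2 * (k.prob false ω * l.prob false η -
      k.prob true ω * l.prob true η) by simp only [ha, hb, hc, hd]; ring,
      show a ω * c η + b ω * d η = 2 * (k.prob false ω * l.prob false η +
      k.prob true ω * l.prob true η) by simp only [ha, hb, hc, hd]; ring,
      mul_pow, ← mul_assoc, show (2 : ℝ) ^ 2 = 2 * 2 by norm_num,
      mul_div_mul_left _ _ (by norm_num)]
  -- Reindexing by the flip changes the sign of `b` and keeps `a`. Twice the sum is thus a sum of
  -- the symmetrized terms bounded in `chi_two_mul_aux`.
  have e1 : ∀ η, ∑ ω, (a ω * d η + b ω * c η) ^ 2 / (2 * (a ω * c η + b ω * d η)) =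
      ∑ ω, (a ω * d η - b ω * c η) ^ 2 / (2 * (a ω * c η - b ω * d η)) := by
    intro η
    refine Fintype.sum_equiv k.flip_flip.toPerm _ _ fun ω => ?_
    have h1 : a (k.flip ω) = a ω := by simp [ha, prob_flip', add_comm]
    have h2 : b (k.flip ω) = - b ω := by simp [hb, prob_flip']
    rw [Function.Involutive.coe_toPerm, h1, h2]
    congr 2 <;> ring
  have e2 : ∑ η, ∑ ω, (b ω ^ 2 / a ω * c η + d η ^ 2 / c η * a ω) =
      2 * ∑ ω, b ω ^ 2 / a ω + 2 * ∑ η, d η ^ 2 / c η := by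
    simp only [Finset.sum_add_distrib, ← Finset.mul_sum, ← Finset.sum_mul, hsa, hsc]
    ring
  have e3 := Finset.sum_le_sum fun η (_ : η ∈ Finset.univ) =>
    Finset.sum_le_sum fun ω (_ : ω ∈ Finset.univ) => chi_two_mul_aux (hab ω) (hcd η)
  rw [e2] at e3
  simp only [Finset.sum_add_distrib] at e3
  simp only [← e1] at e3
  unfold chi
  rw [e0]
  linarith

/-- Independent uses of kernels on the same input bit. -/
def pi {n : ℕ} (k : Fin n → SymKernel Ω) : SymKernel (Fin n → Ω) where
  prob x ω := ∏ j, (k j).prob x (ω j)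
  nonneg x ω := Finset.prod_nonneg fun j _ => (k j).nonneg x _
  sum_eq_one x := by
    rw [← Fintype.piFinset_univ, ← Finset.prod_univ_sum]
    simp [sum_eq_one]
  flip ω j := (k j).flip (ω j)
  flip_flip ω := funext fun j => (k j).flip_flip (ω j)
  prob_flip x ω := Finset.prod_congr rfl fun j _ => (k j).prob_flip x (ω j)

theorem chi_pi_le : ∀ {n : ℕ} (k : Fin n → SymKernel Ω),
    chi (pi k).prob ≤ ∑ j, chi (k j).prob
  | 0, k => by simp [chi, pi]
  | n + 1, k => by
    rw [Fin.sum_univ_succ]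
    refine le_trans (le_of_eq ?_) ((chi_mul_le (k 0) (pi fun j => k j.succ)).trans
      (add_le_add le_rfl (chi_pi_le _)))
    rw [← chi_congr_equiv (Fin.consEquiv fun _ : Fin (n + 1) => Ω)]
    simp [pi, Fin.prod_univ_succ, Fin.consEquiv]

end SymKernel

/-- The binary symmetric channel with flip probability `q`. -/
def bsc (q : ℝ) (x y : Bool) : ℝ := if x = y then 1 - q else q

namespace SymKernel

variable {Ω : Type} [Fintype Ω]

/-- A kernel preceded by a binary symmetric channel. -/
def noisy (q : ℝ) (h0 : 0 ≤ q) (h1 : q ≤ 1) (k : SymKernel Ω) : SymKernel Ω where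
  prob x ω := ∑ y, bsc q x y * k.prob y ω
  nonneg x ω := Finset.sum_nonneg fun y _ =>
    mul_nonneg (by unfold bsc; split_ifs <;> linarith) (k.nonneg y ω)
  sum_eq_one x := by
    rw [Finset.sum_comm]
    simp only [← Finset.mul_sum, k.sum_eq_one]
    cases x <;> simp [bsc]
  flip := k.flip
  flip_flip := k.flip_flip
  prob_flip x ω := by
    cases x <;> simp [bsc, prob_flip'] <;> ring

/-- The flip keeps the sum of the two output probabilities and multiplies their difference by `1 -
2q`. -/
theorem chi_noisy (q : ℝ) (h0 : 0 ≤ q) (h1 : q ≤ 1) (k : SymKernel Ω) :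
    chi (k.noisy q h0 h1).prob = (1 - 2 * q) ^ 2 * chi k.prob := by
  unfold chi
  rw [mul_div_assoc', Finset.mul_sum]
  congr 1
  refine Finset.sum_congr rfl fun ω _ => ?_
  rw [mul_div_assoc', ← mul_pow]
  simp only [noisy, bsc, Fintype.sum_bool]
  congr 1
  · simp; ring
  · simp; ring

/-- The noiseless kernel. -/
def ident : SymKernel Bool where
  prob x y := if x = y then 1 else 0
  nonneg x y := by split_ifs <;> norm_num
  sum_eq_one x := by simp
  flip := not
  flip_flip := Bool.not_not
  prob_flip x y := by cases x <;> cases y <;> simp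

theorem chi_ident : chi ident.prob = 1 := by
  simp [chi, ident]

end SymKernel

/-! ### Tensor products of matrices and of superoperators -/

/-- The tensor product of a family of matrices. -/
def tens {ι m n : Type} [Fintype ι] (A : ι → Matrix m n ℂ) : Matrix (ι → m) (ι → n) ℂ :=
  Matrix.of fun x y => ∏ i, A i (x i) (y i)

section Tens

variable {ι m n l : Type} [Fintype ι]

theorem tens_apply (A : ι → Matrix m n ℂ) (x : ι → m) (y : ι → n) :
    tens A x y = ∏ i, A i (x i) (y i) := rfl

theorem tens_mul [DecidableEq ι] [Fintype n] (A : ι → Matrix m n ℂ) (B : ι → Matrix n l ℂ) :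
    tens A * tens B = tens fun i => A i * B i := by
  ext x y
  simp only [Matrix.mul_apply, tens_apply, ← Finset.prod_mul_distrib]
  rw [Finset.prod_univ_sum, Fintype.piFinset_univ]

theorem tens_conjTranspose (A : ι → Matrix m n ℂ) : (tens A)ᴴ = tens fun i => (A i)ᴴ := by
  ext x y
  simp [tens_apply, Matrix.conjTranspose_apply]

theorem tens_one [DecidableEq m] : tens (fun _ : ι => (1 : Matrix m m ℂ)) = 1 := by
  ext x y
  simp only [tens_apply, Matrix.one_apply, Fintype.prod_ite_zero, funext_iff]
  simp

theorem tens_smul (c : ι → ℂ) (A : ι → Matrix m n ℂ) :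
    tens (fun i => c i • A i) = (∏ i, c i) • tens A := by
  ext x y
  simp [tens_apply, Finset.prod_mul_distrib]

theorem tens_sum [DecidableEq ι] {κ : Type} [Fintype κ] (A : ι → κ → Matrix m n ℂ) :
    tens (fun i => ∑ k, A i k) = ∑ f : ι → κ, tens fun i => A i (f i) := by
  ext x y
  simp only [tens_apply, Matrix.sum_apply]
  rw [Finset.prod_univ_sum, Fintype.piFinset_univ]

theorem tens_eq_zero {A : ι → Matrix m n ℂ} {i : ι} (h : A i = 0) : tens A = 0 := by
  ext x y
  exact Finset.prod_eq_zero (Finset.mem_univ i) (by simp [h])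

theorem tens_single [DecidableEq m] [DecidableEq n] (x : ι → m) (y : ι → n) :
    tens (fun i => Matrix.single (x i) (y i) (1 : ℂ)) = Matrix.single x y 1 := by
  ext a c
  simp only [tens_apply, Matrix.single_apply, Fintype.prod_ite_zero, funext_iff]
  simp [forall_and]

theorem tens_isometry [DecidableEq ι] [Fintype m] [DecidableEq n] {A : ι → Matrix m n ℂ}
    (hA : ∀ i, (A i)ᴴ * A i = 1) : (tens A)ᴴ * tens A = 1 := by
  rw [tens_conjTranspose, tens_mul]
  simp only [hA, tens_one]

/-- The factors of a nonzero tensor product are determined up to scalars. -/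
theorem exists_smul_of_tens_eq_smul [DecidableEq ι] {A B : ι → Matrix m n ℂ} {c : ℂ} (hc : c ≠ 0)
    (hB : ∀ i, B i ≠ 0) (h : tens A = c • tens B) (i : ι) : ∃ d : ℂ, A i = d • B i := by
  have hz : ∀ i, ∃ p : m × n, B i p.1 p.2 ≠ 0 := by
    intro i
    by_contra! h0
    exact hB i (by ext a b; exact h0 (a, b))
  choose p hp using hz
  have key : ∀ a b, A i a b * ∏ j ∈ Finset.univ.erase i, A j (p j).1 (p j).2 =
      c * (B i a b * ∏ j ∈ Finset.univ.erase i, B j (p j).1 (p j).2) := by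
    intro a b
    -- Fixing the entries of all factors but the `i`-th at nonzero entries `p j` of `B j` isolates
    -- `A i` against `B i`.
    have h1 := congrFun (congrFun h (Function.update (fun j => (p j).1) i a))
      (Function.update (fun j => (p j).2) i b)
    simp only [Matrix.smul_apply, tens_apply, smul_eq_mul] at h1
    rw [← Finset.mul_prod_erase _ _ (Finset.mem_univ i),
      ← Finset.mul_prod_erase _ _ (Finset.mem_univ i)] at h1
    simp only [Function.update_self] at h1
    convert h1 using 2
    · refine Finset.prod_congr rfl fun j hj => ?_
      rw [Function.update_of_ne (Finset.ne_of_mem_erase hj),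
        Function.update_of_ne (Finset.ne_of_mem_erase hj)]
    · congr 1
      refine Finset.prod_congr rfl fun j hj => ?_
      rw [Function.update_of_ne (Finset.ne_of_mem_erase hj),
        Function.update_of_ne (Finset.ne_of_mem_erase hj)]
  set α := ∏ j ∈ Finset.univ.erase i, A j (p j).1 (p j).2
  set β := ∏ j ∈ Finset.univ.erase i, B j (p j).1 (p j).2 with hβ
  have hβ0 : β ≠ 0 := Finset.prod_ne_zero_iff.2 fun j _ => hp j
  have hα0 : α ≠ 0 := by
    intro h0
    have := key (p i).1 (p i).2
    rw [h0, mul_zero] at this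
    exact mul_ne_zero hc (mul_ne_zero (hp i) hβ0) this.symm
  refine ⟨c * β / α, ?_⟩
  ext a b
  rw [Matrix.smul_apply, smul_eq_mul, div_mul_eq_mul_div, eq_div_iff hα0, key]
  ring

end Tens

section SuperOps

variable {ι : Type} [Fintype ι] [DecidableEq ι]

theorem SuperOp.apply_eq_sum {n m : Type} [Fintype n] [DecidableEq n] (Φ : SuperOp n m)
    (M : Matrix n n ℂ) (a c : m) :
    Φ M a c = ∑ x, ∑ y, M x y * Φ (Matrix.single x y 1) a c := by
  have h3 : ∀ x y, Matrix.single x y (M x y) = M x y • Matrix.single x y (1 : ℂ) := by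
    intro x y
    simp
  conv_lhs => rw [Matrix.matrix_eq_sum_single M]
  simp only [h3, map_sum, map_smul, Matrix.sum_apply, Matrix.smul_apply, smul_eq_mul]

theorem SuperOp.ext_tens {m n : Type} [Fintype n] [DecidableEq n] {Φ Ψ : SuperOp (ι → n) m}
    (h : ∀ M : ι → Matrix n n ℂ, Φ (tens M) = Ψ (tens M)) : Φ = Ψ := by
  ext M a c
  rw [Φ.apply_eq_sum, Ψ.apply_eq_sum]
  simp only [← tens_single, h]

/-- The tensor product of a family of single-qubit superoperators. -/
def tensorPi (Φ : ι → SuperOp (Fin 2) (Fin 2)) : SuperOp (ι → Fin 2) (ι → Fin 2) where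
  toFun ρ := Matrix.of fun a c => ∑ x : ι → Fin 2, ∑ y : ι → Fin 2,
    ρ x y * ∏ i, Φ i (Matrix.single (x i) (y i) 1) (a i) (c i)
  map_add' ρ τ := by
    ext a c
    simp [add_mul, Finset.sum_add_distrib]
  map_smul' r ρ := by
    ext a c
    simp [mul_assoc, Finset.mul_sum]

theorem tensorPower_eq_tensorPi (Φ : SuperOp (Fin 2) (Fin 2)) :
    tensorPower ι Φ = tensorPi fun _ => Φ := rfl

theorem tensorPi_tens (Φ : ι → SuperOp (Fin 2) (Fin 2)) (M : ι → Matrix (Fin 2) (Fin 2) ℂ) :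
    tensorPi Φ (tens M) = tens fun i => Φ i (M i) := by
  ext a c
  change ∑ x : ι → Fin 2, ∑ y : ι → Fin 2,
    tens M x y * ∏ i, Φ i (Matrix.single (x i) (y i) 1) (a i) (c i) = ∏ i, Φ i (M i) (a i) (c i)
  simp only [tens_apply, ← Finset.prod_mul_distrib]
  have h : ∀ i, Φ i (M i) (a i) (c i) = ∑ x, ∑ y, M i x y *
      Φ i (Matrix.single x y 1) (a i) (c i) := fun i => (Φ i).apply_eq_sum _ _ _
  simp only [h]
  rw [Finset.prod_univ_sum, Fintype.piFinset_univ]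
  refine Finset.sum_congr rfl fun x _ => ?_
  rw [Finset.prod_univ_sum, Fintype.piFinset_univ]

theorem tensorPi_comp (Φ Ψ : ι → SuperOp (Fin 2) (Fin 2)) :
    tensorPi Φ ∘ₗ tensorPi Ψ = tensorPi fun i => Φ i ∘ₗ Ψ i :=
  SuperOp.ext_tens fun M => by simp [tensorPi_tens]

theorem tensorPi_conjBy (A : ι → Matrix (Fin 2) (Fin 2) ℂ) :
    tensorPi (fun i => conjBy (A i)) = conjBy (tens A) :=
  SuperOp.ext_tens fun M => by
    simp [tensorPi_tens, conjBy_apply, tens_mul, tens_conjTranspose]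

theorem tensorPi_sum_smul {κ : Type} [Fintype κ] (c : ι → κ → ℂ)
    (Φ : ι → κ → SuperOp (Fin 2) (Fin 2)) :
    tensorPi (fun i => ∑ k, c i k • Φ i k) =
      ∑ f : ι → κ, (∏ i, c i (f i)) • tensorPi fun i => Φ i (f i) :=
  SuperOp.ext_tens fun M => by
    simp [tensorPi_tens, tens_sum, tens_smul]

end SuperOps

/-! ### Pauli matrices and flips -/

theorem Pauli.matrix_conjTranspose (a : Pauli) : a.matrixᴴ = a.matrix := by
  cases a <;> ext i j <;> fin_cases i <;> fin_cases j <;> simp [Pauli.matrix]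

theorem Pauli.matrix_mul_self (a : Pauli) : a.matrix * a.matrix = 1 := by
  cases a <;> ext i j <;> fin_cases i <;> fin_cases j <;>
    simp [Pauli.matrix, Matrix.mul_apply, Fin.sum_univ_two]

/-- Pauli matrices commute up to sign, which conjugation does not see. -/
theorem Pauli.conj_comm (a b : Pauli) :
    conjBy a.matrix ∘ₗ conjBy b.matrix = conjBy b.matrix ∘ₗ conjBy a.matrix := by
  rw [conjBy_comp, conjBy_comp]
  have : ∃ s : ℂ, ‖s‖ = 1 ∧ a.matrix * b.matrix = s • (b.matrix * a.matrix) := by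
    by_cases h : a = .I ∨ b = .I ∨ a = b
    · refine ⟨1, by simp, ?_⟩
      rcases h with h | h | h <;> simp [h, Pauli.matrix]
    · refine ⟨-1, by simp, ?_⟩
      cases a <;> cases b <;> simp at h <;> ext i j <;> fin_cases i <;> fin_cases j <;>
        simp [Pauli.matrix, Matrix.mul_apply, Fin.sum_univ_two]
  obtain ⟨s, hs, h⟩ := this
  rw [h, conjBy_smul hs]

theorem Pauli.eq_of_matrix_eq_smul {a b : Pauli} {c : ℂ} (h : a.matrix = c • b.matrix) :
    a = b := by
  have h1 := congrFun₂ h 0 0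
  have h2 := congrFun₂ h 0 1
  have h3 := congrFun₂ h 1 0
  have h4 := congrFun₂ h 1 1
  have hI : Complex.I ≠ 0 := Complex.I_ne_zero
  cases a <;> cases b <;> simp [Pauli.matrix] at h1 h2 h3 h4 ⊢ <;> grind

theorem Pauli.matrix_ne_zero (a : Pauli) : a.matrix ≠ 0 := fun h => by
  have := a.matrix_mul_self
  rw [h, mul_zero] at this
  exact zero_ne_one this

/-- The power `σ_a ^ x` for a bit `x`. -/
def Pauli.pow (a : Pauli) (x : Bool) : Pauli := if x then a else .I

theorem conjBy_I : conjBy Pauli.I.matrix = LinearMap.id := conjBy_one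

theorem pauliFlip_eq_sum (a : Pauli) (q : ℝ) :
    pauliFlip a q = ∑ x : Bool, (bsc q false x : ℂ) • conjBy (a.pow x).matrix := by
  simp [pauliFlip, bsc, Pauli.pow, conjBy_I, add_comm]

theorem isChannel_tensorPi_pauliFlip {ι : Type} [Fintype ι] [DecidableEq ι] (a : ι → Pauli)
    {q : ι → ℝ} (h0 : ∀ i, 0 ≤ q i) (h1 : ∀ i, q i ≤ 1) :
    IsChannel (tensorPi fun i => pauliFlip (a i) (q i)) := by
  simp only [pauliFlip_eq_sum, tensorPi_sum_smul, tensorPi_conjBy, ← Complex.ofReal_prod]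
  refine IsChannel.sum_smul (fun f => Finset.prod_nonneg fun i _ => ?_) ?_ fun f => ?_
  · unfold bsc
    split_ifs <;> linarith [h0 i, h1 i]
  · rw [← Fintype.piFinset_univ, ← Finset.prod_univ_sum]
    simp [bsc]
  · exact isChannel_conjBy (tens_isometry fun i => by
      rw [Pauli.matrix_conjTranspose, Pauli.matrix_mul_self])

/-- The passage from quantum to classical: noise along `a` acts on the exponent of `σ_a ^ x` as a
binary symmetric channel. -/
theorem pauliFlip_comp_conj (a : Pauli) (q : ℝ) (x : Bool) :
    pauliFlip a q ∘ₗ conjBy (a.pow x).matrix =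
      ∑ y : Bool, (bsc q x y : ℂ) • conjBy (a.pow y).matrix := by
  have h : conjBy a.matrix ∘ₗ conjBy a.matrix = LinearMap.id := by
    rw [conjBy_comp, a.matrix_mul_self, conjBy_one]
  cases x
  · simp [pauliFlip, bsc, Pauli.pow, conjBy_I, add_comm]
  · simp [pauliFlip, bsc, Pauli.pow, conjBy_I, LinearMap.add_comp, LinearMap.smul_comp, h]

theorem pauliFlip_comm (a b : Pauli) (p q : ℝ) :
    pauliFlip a p ∘ₗ pauliFlip b q = pauliFlip b q ∘ₗ pauliFlip a p := by
  simp only [pauliFlip, LinearMap.add_comp, LinearMap.comp_add, LinearMap.smul_comp,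
    LinearMap.comp_smul, LinearMap.id_comp, LinearMap.comp_id, a.conj_comm b]
  module

theorem pauliFlip_comp_conj_comm (a b : Pauli) (p : ℝ) :
    pauliFlip a p ∘ₗ conjBy b.matrix = conjBy b.matrix ∘ₗ pauliFlip a p := by
  simp only [pauliFlip, LinearMap.add_comp, LinearMap.comp_add, LinearMap.smul_comp,
    LinearMap.comp_smul, LinearMap.id_comp, LinearMap.comp_id, a.conj_comm b]

theorem pauliFlip_zero (a : Pauli) : pauliFlip a 0 = LinearMap.id := by
  simp [pauliFlip]

theorem pauliFlip_I (p : ℝ) : pauliFlip .I p = LinearMap.id := by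
  rw [pauliFlip, conjBy_I, ← add_smul, ← Complex.ofReal_add]
  simp

/-- Independent flips along the three axes. -/
def axisFlips (p : Pauli → ℝ) : SuperOp (Fin 2) (Fin 2) :=
  pauliFlip .X (p .X) ∘ₗ pauliFlip .Y (p .Y) ∘ₗ pauliFlip .Z (p .Z)

theorem axisFlips_comp_conj_comm (p : Pauli → ℝ) (b : Pauli) :
    axisFlips p ∘ₗ conjBy b.matrix = conjBy b.matrix ∘ₗ axisFlips p := by
  unfold axisFlips
  rw [LinearMap.comp_assoc, LinearMap.comp_assoc, pauliFlip_comp_conj_comm,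
    ← LinearMap.comp_assoc (pauliFlip .Z _), pauliFlip_comp_conj_comm, LinearMap.comp_assoc,
    ← LinearMap.comp_assoc (_ ∘ₗ _), pauliFlip_comp_conj_comm, LinearMap.comp_assoc]

/-- Flips along different axes commute, so any one of them can be moved to the front. For `a = .I`
the extracted factor is trivial. -/
theorem axisFlips_eq_pauliFlip_comp {p q : Pauli → ℝ} {a : Pauli} (ha : q a = 0)
    (h : ∀ b, b ≠ a → q b = p b) : axisFlips p = pauliFlip a (p a) ∘ₗ axisFlips q := by
  unfold axisFlips
  cases a
  · rw [h .X (by simp), h .Y (by simp), h .Z (by simp), pauliFlip_I, LinearMap.id_comp]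
  · rw [ha, h .Y (by simp), h .Z (by simp), pauliFlip_zero, LinearMap.id_comp]
  · rw [ha, h .X (by simp), h .Z (by simp), pauliFlip_zero, LinearMap.id_comp,
      ← LinearMap.comp_assoc, pauliFlip_comm, LinearMap.comp_assoc]
  · rw [ha, h .X (by simp), h .Y (by simp), pauliFlip_zero, LinearMap.comp_id,
      pauliFlip_comm .Y .Z, ← LinearMap.comp_assoc, pauliFlip_comm .X .Z, LinearMap.comp_assoc]

theorem isChannel_tensorPi_axisFlips {ι : Type} [Fintype ι] [DecidableEq ι]
    {p : ι → Pauli → ℝ} (h0 : ∀ i a, 0 ≤ p i a) (h1 : ∀ i a, p i a ≤ 1) :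
    IsChannel (tensorPi fun i => axisFlips (p i)) := by
  unfold axisFlips
  simp only [← tensorPi_comp]
  exact (isChannel_tensorPi_pauliFlip _ (fun i => h0 i _) fun i => h1 i _).comp
    ((isChannel_tensorPi_pauliFlip _ (fun i => h0 i _) fun i => h1 i _).comp
      (isChannel_tensorPi_pauliFlip _ (fun i => h0 i _) fun i => h1 i _))

theorem conjBy_X_apply (ρ : Matrix (Fin 2) (Fin 2) ℂ) :
    conjBy Pauli.X.matrix ρ = !![ρ 1 1, ρ 1 0; ρ 0 1, ρ 0 0] := by
  ext i j
  simp only [conjBy_apply, Pauli.matrix_conjTranspose, Matrix.mul_apply, Fin.sum_univ_two]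
  fin_cases i <;> fin_cases j <;> simp [Pauli.matrix]

theorem conjBy_Y_apply (ρ : Matrix (Fin 2) (Fin 2) ℂ) :
    conjBy Pauli.Y.matrix ρ = !![ρ 1 1, -ρ 1 0; -ρ 0 1, ρ 0 0] := by
  ext i j
  simp only [conjBy_apply, Pauli.matrix_conjTranspose, Matrix.mul_apply, Fin.sum_univ_two]
  fin_cases i <;> fin_cases j <;> simp [Pauli.matrix, mul_right_comm]

theorem conjBy_Z_apply (ρ : Matrix (Fin 2) (Fin 2) ℂ) :
    conjBy Pauli.Z.matrix ρ = !![ρ 0 0, -ρ 0 1; -ρ 1 0, ρ 1 1] := by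
  ext i j
  simp only [conjBy_apply, Pauli.matrix_conjTranspose, Matrix.mul_apply, Fin.sum_univ_two]
  fin_cases i <;> fin_cases j <;> simp [Pauli.matrix]

/-- Each nontrivial Pauli matrix anticommutes with two of the three axes, so it is damped by `(1 -
2q)²`. -/
theorem depolarizing_eq_axisFlips {ε q : ℝ} (h : (1 - 2 * q) ^ 2 = 1 - ε) :
    depolarizing ε = axisFlips fun _ => q := by
  obtain rfl : ε = 1 - (1 - 2 * q) ^ 2 := by linarith
  refine LinearMap.ext fun ρ => Matrix.ext fun i j => ?_
  simp only [depolarizing, axisFlips, pauliFlip, LinearMap.add_apply, LinearMap.smul_apply,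
    LinearMap.id_apply, LinearMap.comp_apply, LinearMap.smulRight_apply,
    Matrix.traceLinearMap_apply, conjBy_X_apply, conjBy_Y_apply, conjBy_Z_apply, Matrix.add_apply,
    Matrix.smul_apply, smul_eq_mul, Matrix.trace_fin_two]
  fin_cases i <;> fin_cases j <;> simp <;> ring

/-! ### Nodes and their children -/

/-- Functions on a level are the same as functions on the pairs of a node of the previous level
and an index of a child. -/
def childrenEquiv (b t : ℕ) (α : Type) : (Level b (t + 1) → α) ≃ (Level b t → Fin b → α) where
  toFun x v j := x (Fin.snoc (α := fun _ => Fin b) v j)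
  invFun y u := y (Fin.init u) (u (Fin.last t))
  left_inv x := by
    funext u
    exact congrArg x (Fin.snoc_init_self u)
  right_inv y := by
    funext v j
    simp

theorem childrenEquiv_apply {b t : ℕ} {α : Type} (x : Level b (t + 1) → α) (v : Level b t)
    (j : Fin b) : childrenEquiv b t α x v j = x (Fin.snoc (α := fun _ => Fin b) v j) := rfl

theorem prod_level_succ {M : Type} [CommMonoid M] {b t : ℕ} (f : Level b (t + 1) → M) :
    ∏ u, f u = ∏ v : Level b t, ∏ j, childrenEquiv b t M f v j := by
  rw [← Fintype.prod_prod_type']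
  refine (Fintype.prod_equiv ((Equiv.prodComm _ _).trans
    (Fin.snocEquiv fun _ : Fin (t + 1) => Fin b)) _ _ fun _ => rfl).symm

theorem sum_level_succ {M : Type} [AddCommMonoid M] {b t : ℕ} (f : Level b (t + 1) → M) :
    ∑ u, f u = ∑ v : Level b t, ∑ j, childrenEquiv b t M f v j :=
  prod_level_succ (M := Multiplicative M) f

theorem tens_level_succ {b t : ℕ} (D : Level b (t + 1) → Matrix (Fin 2) (Fin 2) ℂ) :
    tens D = (tens fun v => tens (childrenEquiv b t _ D v)).submatrix
      (childrenEquiv b t (Fin 2)) (childrenEquiv b t (Fin 2)) := by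
  ext x y
  exact prod_level_succ _

/-! ### Broadcasting -/

/-- Bits at the positions `ι`, distributed according to `P x` where `x` is the root bit, such that
the information about `x` in any symmetric observation of the single bits is at most `c` times
the total information in the observations of the bits in `S`. -/
structure IsBroadcast {ι : Type} [Fintype ι] [DecidableEq ι] (S : Finset ι) (c : ℝ)
    (P : Bool → (ι → Bool) → ℝ) : Prop where
  nonneg : ∀ x y, 0 ≤ P x y
  sum_eq_one : ∀ x, ∑ y, P x y = 1
  chi_le : ∀ (Ω : Type) [Fintype Ω] (k : ι → SymKernel Ω),
    chi (fun x (ω : ι → Ω) => ∑ y, P x y * ∏ i, (k i).prob (y i) (ω i)) ≤ c * ∑ i ∈ S, chi (k i).prob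

/-- The bits are observed without noise: each identity kernel carries information 1. -/
theorem IsBroadcast.sq_sum_abs_sub_le {ι : Type} [Fintype ι] [DecidableEq ι] {S : Finset ι} {c : ℝ}
    {P : Bool → (ι → Bool) → ℝ} (h : IsBroadcast S c P) :
    ((∑ y, |P false y - P true y|) / 2) ^ 2 ≤ c * S.card := by
  have h1 := h.chi_le Bool fun _ => SymKernel.ident
  have h2 : ∀ x ω, ∑ y, P x y * ∏ i, SymKernel.ident.prob (y i) (ω i) = P x ω := fun x ω => by
    simp only [SymKernel.ident, Fintype.prod_boole, ← funext_iff]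
    simp
  simp only [h2, SymKernel.chi_ident, Finset.sum_const, nsmul_eq_mul, mul_one] at h1
  exact (sq_sum_abs_sub_le_chi h.nonneg h.sum_eq_one).trans h1

theorem isBroadcast_root (b : ℕ) {S : Finset (Level b 0)} (hS : S = Finset.univ) :
    IsBroadcast S 1 fun x y => if y = fun _ => x then 1 else 0 where
  nonneg x y := by split_ifs <;> norm_num
  sum_eq_one x := by simp
  chi_le Ω _ k := by
    subst hS
    simp only [ite_mul, one_mul, zero_mul, Finset.sum_ite_eq', Finset.mem_univ, if_true,
      Fintype.prod_unique, Fintype.sum_unique]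
    exact le_of_eq (chi_congr_equiv (Equiv.funUnique (Level b 0) Ω) (k default).prob)

/-- Observing the noisy copies of a bit at the children of `v` is one symmetric observation `K v` of
the bit at `v`. Hence the bound at level `t`, being valid for all observations, applies to `K`;
subadditivity and contraction bound the information in `K v`. -/
theorem IsBroadcast.step {b t : ℕ} {S : Finset (Level b t)} {c : ℝ}
    {P : Bool → (Level b t → Bool) → ℝ} (h : IsBroadcast S c P) (hc : 0 ≤ c)
    {S' : Finset (Level b (t + 1))} {d : ℝ} {q : Level b (t + 1) → ℝ} (h0 : ∀ u, 0 ≤ q u)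
    (h1 : ∀ u, q u ≤ 1) (hq : ∀ u, (1 - 2 * q u) ^ 2 ≤ if u ∈ S' then d else 0) :
    IsBroadcast S' (c * d)
      fun x y' => ∑ y, P x y * ∏ u, bsc (q u) (y (Fin.init u)) (y' u) where
  nonneg x y' := Finset.sum_nonneg fun y _ => mul_nonneg (h.nonneg x y) <|
    Finset.prod_nonneg fun u _ => by unfold bsc; split_ifs <;> linarith [h0 u, h1 u]
  sum_eq_one x := by
    rw [Finset.sum_comm, ← h.sum_eq_one x]
    refine Finset.sum_congr rfl fun y _ => ?_
    rw [← Finset.mul_sum, ← Fintype.piFinset_univ, ← Finset.prod_univ_sum]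
    have : ∀ q x, ∑ y, bsc q x y = 1 := by
      intro q x
      cases x <;> simp [bsc]
    simp only [this, Finset.prod_const_one, mul_one]
  chi_le Ω _ k := by
    set K : Level b t → SymKernel (Fin b → Ω) := fun v => SymKernel.pi fun j =>
      (k (Fin.snoc (α := fun _ => Fin b) v j)).noisy (q (Fin.snoc (α := fun _ => Fin b) v j))
        (h0 _) (h1 _) with hK
    have e : ∀ x (ω : Level b (t + 1) → Ω),
        ∑ y' : Level b (t + 1) → Bool, (∑ y, P x y * ∏ u, bsc (q u) (y (Fin.init u)) (y' u)) *
          ∏ u, (k u).prob (y' u) (ω u) =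
        ∑ y, P x y * ∏ v, (K v).prob (y v) (childrenEquiv b t Ω ω v) := by
      intro x ω
      simp only [Finset.sum_mul]
      rw [Finset.sum_comm]
      refine Finset.sum_congr rfl fun y _ => ?_
      simp only [mul_assoc, ← Finset.mul_sum, ← Finset.prod_mul_distrib]
      rw [← Fintype.piFinset_univ, ← Finset.prod_univ_sum (fun _ => Finset.univ)
        (fun u z => bsc (q u) (y (Fin.init u)) z * (k u).prob z (ω u)), prod_level_succ]
      simp [hK, SymKernel.pi, SymKernel.noisy, childrenEquiv_apply]
    simp only [e]
    rw [chi_congr_equiv (childrenEquiv b t Ω)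
      fun x η => ∑ y, P x y * ∏ v, (K v).prob (y v) (η v)]
    refine (h.chi_le _ K).trans ?_
    rw [mul_assoc]
    refine mul_le_mul_of_nonneg_left ?_ hc
    have hk : ∀ u, 0 ≤ chi (k u).prob := fun u => chi_nonneg (k u).nonneg
    calc ∑ v ∈ S, chi (K v).prob
        -- Only the set at the last level enters the final bound, so `S` can be enlarged to all
        -- nodes.
        ≤ ∑ v, chi (K v).prob := Finset.sum_le_univ_sum_of_nonneg fun v => chi_nonneg (K v).nonneg
      _ ≤ ∑ v, ∑ j, childrenEquiv b t ℝ (fun u => (1 - 2 * q u) ^ 2 * chi (k u).prob) v j := by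
          refine Finset.sum_le_sum fun v _ => (SymKernel.chi_pi_le _).trans (le_of_eq ?_)
          simp only [SymKernel.chi_noisy, childrenEquiv_apply]
      _ = ∑ u, (1 - 2 * q u) ^ 2 * chi (k u).prob := (sum_level_succ _).symm
      _ ≤ ∑ u, (if u ∈ S' then d else 0) * chi (k u).prob :=
          Finset.sum_le_sum fun u _ => mul_le_mul_of_nonneg_right (hq u) (hk u)
      _ = d * ∑ u ∈ S', chi (k u).prob := by
          rw [Finset.mul_sum]
          simp

/-! ### Encoders -/

variable {b : ℕ} [NeZero b]

/-- The computational basis state of a node with data bit `s`. -/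
def dataState (b : ℕ) [NeZero b] (s : Fin 2) : Fin b → Fin 2 := Function.update (fun _ => 0) 0 s

theorem dataState_injective : Function.Injective (dataState b) := fun s s' h => by
  simpa [dataState] using congrFun h 0

theorem encoder_eq_submatrix (V : Matrix (Fin b → Fin 2) (Fin b → Fin 2) ℂ) :
    encoder V = V.submatrix id (dataState b) := rfl

theorem encoder_isometry {V : Matrix (Fin b → Fin 2) (Fin b → Fin 2) ℂ}
    (hV : V ∈ Matrix.unitaryGroup (Fin b → Fin 2) ℂ) : (encoder V)ᴴ * encoder V = 1 := by
  have h : Vᴴ * V = 1 := Matrix.mem_unitaryGroup_iff'.1 hV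
  rw [encoder_eq_submatrix, Matrix.conjTranspose_submatrix,
    ← Matrix.submatrix_mul _ _ _ _ _ Function.bijective_id, h,
    Matrix.submatrix_one _ dataState_injective]

theorem layer_eq_submatrix (U : Unitaries b) (t : ℕ) :
    layer U t = (tens fun v => encoder (U t v)).submatrix (childrenEquiv b t (Fin 2)) id := rfl

theorem tens_mul_layer (U : Unitaries b) {t : ℕ}
    (D : Level b (t + 1) → Matrix (Fin 2) (Fin 2) ℂ) :
    tens D * layer U t = (tens fun v => tens (childrenEquiv b t _ D v) *
      encoder (U t v)).submatrix (childrenEquiv b t (Fin 2)) id := by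
  rw [layer_eq_submatrix, tens_level_succ, Matrix.submatrix_mul_equiv, tens_mul]

theorem layer_mul_tens (U : Unitaries b) {t : ℕ} (B : Level b t → Matrix (Fin 2) (Fin 2) ℂ) :
    layer U t * tens B =
      (tens fun v => encoder (U t v) * B v).submatrix (childrenEquiv b t (Fin 2)) id := by
  rw [layer_eq_submatrix, ← tens_mul]
  rfl

theorem conjTranspose_layer_mul_submatrix (U : Unitaries b) {t : ℕ}
    (A : Level b t → Matrix (Fin b → Fin 2) (Fin 2) ℂ) :
    (layer U t)ᴴ * (tens A).submatrix (childrenEquiv b t (Fin 2)) id =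
      tens fun v => (encoder (U t v))ᴴ * A v := by
  rw [layer_eq_submatrix, Matrix.conjTranspose_submatrix, Matrix.submatrix_mul_equiv,
    tens_conjTranspose, tens_mul, Matrix.submatrix_id_id]

theorem layer_isometry {U : Unitaries b} {t : ℕ}
    (hU : ∀ v, U t v ∈ Matrix.unitaryGroup (Fin b → Fin 2) ℂ) :
    (layer U t)ᴴ * layer U t = 1 := by
  refine (conjTranspose_layer_mul_submatrix U fun v => encoder (U t v)).trans ?_
  simp only [fun v => encoder_isometry (hU v), tens_one]

theorem rootIso_eq_submatrix (b : ℕ) : rootIso b =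
    (1 : Matrix (Level b 0 → Fin 2) (Level b 0 → Fin 2) ℂ).submatrix id
      (Equiv.funUnique (Level b 0) (Fin 2)).symm := by
  ext x s
  simp only [rootIso, Matrix.of_apply, Matrix.submatrix_apply, Matrix.one_apply, id]
  congr 1
  rw [Equiv.eq_symm_apply, Equiv.funUnique_apply, Subsingleton.elim (default : Level b 0) Fin.elim0]

theorem rootIso_isometry (b : ℕ) : (rootIso b)ᴴ * rootIso b = 1 := by
  rw [rootIso_eq_submatrix, Matrix.conjTranspose_submatrix,
    ← Matrix.submatrix_mul _ _ _ _ _ Function.bijective_id, Matrix.conjTranspose_one,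
    Matrix.one_mul, Matrix.submatrix_one _ (Equiv.injective _)]

theorem rootIso_mul_conjTranspose (b : ℕ) : rootIso b * (rootIso b)ᴴ = 1 := by
  rw [rootIso_eq_submatrix, Matrix.conjTranspose_submatrix, Matrix.submatrix_mul_equiv]
  simp

theorem tens_mul_rootIso (A : Matrix (Fin 2) (Fin 2) ℂ) :
    tens (fun _ : Level b 0 => A) * rootIso b = rootIso b * A := by
  have h0 : (Fin.elim0 : Level b 0) = default := Subsingleton.elim _ _
  ext x s
  simp only [Matrix.mul_apply, rootIso, Matrix.of_apply, tens_apply, Fintype.prod_unique, h0]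
  rw [Finset.sum_eq_single (fun _ => s), Finset.sum_eq_single (x default)]
  · rw [if_pos rfl, if_pos rfl, mul_one, one_mul]
    exact congrArg (fun i => A (x i) s) (Subsingleton.elim _ _)
  · intro y _ hy
    rw [if_neg hy.symm, zero_mul]
  · simp
  · intro y _ hy
    rw [if_neg, mul_zero]
    rintro rfl
    exact hy (funext fun i => congrArg y (Subsingleton.elim _ _))
  · simp

theorem concatEncoder_isometry {U : Unitaries b}
    (hU : ∀ t v, U t v ∈ Matrix.unitaryGroup (Fin b → Fin 2) ℂ) :
    ∀ T, (concatEncoder U T)ᴴ * concatEncoder U T = 1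
  | 0 => rootIso_isometry b
  | T + 1 => by
    rw [concatEncoder, Matrix.conjTranspose_mul, Matrix.mul_assoc,
      ← Matrix.mul_assoc (layer U T)ᴴ, layer_isometry (hU T), Matrix.one_mul,
      concatEncoder_isometry hU T]

/-! ### Chains of logical operators -/

/-- The Pauli string `s` on the output qubits of the encoder `V` acts, up to a phase, as the
Pauli matrix `a` on its data qubit. -/
def ActsAs (V : Matrix (Fin b → Fin 2) (Fin 2) ℂ) (s : Fin b → Pauli) (a : Pauli) : Prop :=
  ∃ c : ℂ, ‖c‖ = 1 ∧ tens (fun j => (s j).matrix) * V = c • (V * a.matrix)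

/-- The Pauli string `s` is the last term of a chain of Pauli strings, one for each level, which
starts with `w` at the root; each encoder maps a letter of the chain to the letters at the
children of its node, and all the letters below the root satisfy `A`. -/
def HasChain (U : Unitaries b) (w : Pauli) (A : Pauli → Prop) :
    (T : ℕ) → (Level b T → Pauli) → Prop
  | 0, s => s = fun _ => w
  | T + 1, s => (∀ u, A (s u)) ∧ ∃ s', HasChain U w A T s' ∧
      ∀ v, ActsAs (encoder (U T v)) (childrenEquiv b T Pauli s v) (s' v)

theorem tens_matrix_isometry {ι : Type} [Fintype ι] [DecidableEq ι] (s : ι → Pauli) :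
    (tens fun i => (s i).matrix)ᴴ * (tens fun i => (s i).matrix) = 1 :=
  tens_isometry fun i => by rw [Pauli.matrix_conjTranspose, Pauli.matrix_mul_self]

theorem PauliOp.toMatrix_eq {ι : Type} [Fintype ι] (P : PauliOp ι) :
    P.toMatrix = P.phase • tens fun i => (P.string i).matrix := rfl

theorem PauliOp.norm_phase {ι : Type} (P : PauliOp ι) : ‖P.phase‖ = 1 :=
  Complex.norm_eq_one_of_pow_eq_one P.phase_pow (by norm_num)

theorem isometry_mul {l m n : Type} [Fintype l] [Fintype m] [DecidableEq m] [DecidableEq n]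
    {A : Matrix l m ℂ} {B : Matrix m n ℂ} (hA : Aᴴ * A = 1) (hB : Bᴴ * B = 1) :
    (A * B)ᴴ * (A * B) = 1 := by
  rw [Matrix.conjTranspose_mul, Matrix.mul_assoc, ← Matrix.mul_assoc Aᴴ, hA, Matrix.one_mul, hB]

theorem norm_eq_one_of_isometry {m n : Type} [Fintype m] [DecidableEq n] [Nonempty n]
    {A B : Matrix m n ℂ} {c : ℂ} (hA : Aᴴ * A = 1) (hB : Bᴴ * B = 1) (h : A = c • B) :
    ‖c‖ = 1 := by
  rw [h, Matrix.conjTranspose_smul, Matrix.smul_mul, Matrix.mul_smul, hB, smul_smul] at hA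
  obtain ⟨i⟩ := ‹Nonempty n›
  have h1 := congrFun₂ hA i i
  simp only [Matrix.smul_apply, Matrix.one_apply_eq, smul_eq_mul, mul_one, Complex.star_def,
    Complex.conj_mul'] at h1
  have h2 : ‖c‖ ^ 2 = 1 := by exact_mod_cast h1
  exact (pow_eq_one_iff_of_nonneg (norm_nonneg c) two_ne_zero).1 h2

theorem string_eq_of_tens_eq_smul {ι : Type} [Fintype ι] [DecidableEq ι] {s s' : ι → Pauli}
    {c : ℂ} (hc : c ≠ 0)
    (h : tens (fun i => (s i).matrix) = c • tens fun i => (s' i).matrix) : s = s' := by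
  funext i
  obtain ⟨d, hd⟩ := exists_smul_of_tens_eq_smul hc (fun i => (s' i).matrix_ne_zero) h i
  exact Pauli.eq_of_matrix_eq_smul hd

/-- Both sides are tensor products over the nodes, so their factors agree up to scalars; these have
modulus 1 because all factors are isometries. -/
theorem actsAs_of_mul_layer_eq {U : Unitaries b} {t : ℕ}
    (hU : ∀ v, U t v ∈ Matrix.unitaryGroup (Fin b → Fin 2) ℂ)
    {P : PauliOp (Level b (t + 1))} {Q : PauliOp (Level b t)}
    (h : P.toMatrix * layer U t = layer U t * Q.toMatrix) (v : Level b t) :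
    ActsAs (encoder (U t v)) (childrenEquiv b t Pauli P.string v) (Q.string v) := by
  have hP : P.phase ≠ 0 := norm_ne_zero_iff.1 (by rw [P.norm_phase]; norm_num)
  have hQ : Q.phase ≠ 0 := norm_ne_zero_iff.1 (by rw [Q.norm_phase]; norm_num)
  rw [P.toMatrix_eq, Q.toMatrix_eq, Matrix.smul_mul, Matrix.mul_smul, tens_mul_layer,
    layer_mul_tens] at h
  have hA : ∀ v, (tens (fun j => (childrenEquiv b t Pauli P.string v j).matrix) *
      encoder (U t v))ᴴ * (tens (fun j => (childrenEquiv b t Pauli P.string v j).matrix) *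
      encoder (U t v)) = 1 := fun v =>
    isometry_mul (tens_matrix_isometry _) (encoder_isometry (hU v))
  have hB : ∀ v, (encoder (U t v) * (Q.string v).matrix)ᴴ *
      (encoder (U t v) * (Q.string v).matrix) = 1 := fun v =>
    isometry_mul (encoder_isometry (hU v))
      (by rw [Pauli.matrix_conjTranspose, Pauli.matrix_mul_self])
  have h' : (tens fun v => tens (fun j => (childrenEquiv b t Pauli P.string v j).matrix) *
      encoder (U t v)) = (P.phase⁻¹ * Q.phase) • tens fun v =>
        encoder (U t v) * (Q.string v).matrix := by
    ext x y
    obtain ⟨x, rfl⟩ := (childrenEquiv b t (Fin 2)).surjective x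
    have h1 := congrFun₂ h x y
    simp only [Matrix.smul_apply, Matrix.submatrix_apply, id, smul_eq_mul] at h1
    rw [Matrix.smul_apply, smul_eq_mul, mul_assoc, ← h1, inv_mul_cancel_left₀ hP]
    rfl
  obtain ⟨d, hd⟩ := exists_smul_of_tens_eq_smul (mul_ne_zero (inv_ne_zero hP) hQ)
    (fun v h0 => by
      have := hB v
      rw [h0, Matrix.mul_zero] at this
      exact zero_ne_one this) h' v
  exact ⟨d, norm_eq_one_of_isometry (hA v) (hB v) hd, hd⟩

theorem HasYFreeChain.hasChain {U : Unitaries b}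
    (hU : ∀ t v, U t v ∈ Matrix.unitaryGroup (Fin b → Fin 2) ℂ) {T : ℕ} {w : Pauli}
    {L : PauliOp (Level b T)} (h : HasYFreeChain U T w L) :
    HasChain U w (fun a => a ≠ .Y) T L.string := by
  obtain ⟨C, h0, rfl, hY, hC⟩ := h
  suffices H : ∀ t ≤ T, HasChain U w (fun a => a ≠ .Y) t (C t).string from H T le_rfl
  intro t
  induction t with
  | zero =>
    intro _
    rw [h0]
    rfl
  | succ t ih =>
    intro ht
    exact ⟨hY _ ht, (C t).string, ih (by omega), actsAs_of_mul_layer_eq (hU t) (hC t ht)⟩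

/-! ### Chains of logical operators of Clifford encoders -/

instance : Finite Pauli :=
  Finite.of_injective (β := Fin 4) (fun | .I => 0 | .X => 1 | .Y => 2 | .Z => 3)
    (by intro a b; cases a <;> cases b <;> simp)

/-- The definition conjugates Paulis by `V`, whereas a string is needed on the input side.
Conjugation is injective on strings, up to phase, and there are finitely many, so it is also
surjective. -/
theorem IsClifford.exists_string {ι : Type} [Fintype ι] [DecidableEq ι]
    {V : Matrix (ι → Fin 2) (ι → Fin 2) ℂ} (hV : IsClifford V) (s : ι → Pauli) :
    ∃ (s' : ι → Pauli) (c : ℂ), ‖c‖ = 1 ∧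
      tens (fun i => (s i).matrix) * V = c • (V * tens fun i => (s' i).matrix) := by
  have h1 : Vᴴ * V = 1 := Matrix.mem_unitaryGroup_iff'.1 hV.1
  have h2 : ∀ s : ι → Pauli, ∃ (s' : ι → Pauli) (c : ℂ), ‖c‖ = 1 ∧
      V * tens (fun i => (s i).matrix) = c • ((tens fun i => (s' i).matrix) * V) := by
    intro s
    obtain ⟨Q, hQ⟩ := hV.2 ⟨1, one_pow 4, s⟩
    refine ⟨Q.string, Q.phase, Q.norm_phase, ?_⟩
    rw [Q.toMatrix_eq, PauliOp.toMatrix_eq, one_smul] at hQ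
    rw [← Matrix.smul_mul, ← hQ, Matrix.mul_assoc _ Vᴴ, h1, Matrix.mul_one]
  choose f c hc hf using h2
  have hc0 : ∀ s, c s ≠ 0 := fun s => norm_ne_zero_iff.1 (by rw [hc]; norm_num)
  have hinj : Function.Injective f := by
    intro s s' h
    refine string_eq_of_tens_eq_smul (c := c s * (c s')⁻¹)
      (mul_ne_zero (hc0 _) (inv_ne_zero (hc0 _))) ?_
    have e : V * tens (fun i => (s i).matrix) =
        (c s * (c s')⁻¹) • (V * tens fun i => (s' i).matrix) := by
      rw [hf s', smul_smul, inv_mul_cancel_right₀ (hc0 s'), ← h, hf s]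
    have e' := congrArg (Vᴴ * ·) e
    simpa only [Matrix.mul_smul, ← Matrix.mul_assoc, h1, Matrix.one_mul] using e'
  obtain ⟨s', rfl⟩ := Finite.injective_iff_surjective.1 hinj s
  refine ⟨s', (c s')⁻¹, by rw [norm_inv, hc, inv_one], ?_⟩
  rw [hf, smul_smul, inv_mul_cancel₀ (hc0 _), one_smul]

theorem Pauli.matrix_zero_zero (a : Pauli) :
    (a.matrix 0 0 = 1 ∧ a.matrix 1 0 = 0) ∨ a.matrix 0 0 = 0 := by
  cases a <;> simp [Pauli.matrix]

theorem tens_submatrix_dataState {s : Fin b → Pauli}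
    (hs : ∀ j ≠ 0, (s j).matrix 0 0 = 1 ∧ (s j).matrix 1 0 = 0) :
    (tens fun j => (s j).matrix).submatrix id (dataState b) =
      (1 : Matrix (Fin b → Fin 2) (Fin b → Fin 2) ℂ).submatrix id (dataState b) *
        (s 0).matrix := by
  ext x y
  simp only [Matrix.submatrix_apply, Matrix.mul_apply, id, Matrix.one_apply, tens_apply]
  have hd : ∀ z, ∀ j ≠ (0 : Fin b), dataState b z j = 0 := fun z j hj => by
    simp [dataState, hj]
  have hd0 : ∀ z, dataState b z 0 = z := fun z => by simp [dataState]
  by_cases hx : ∀ j ≠ 0, x j = 0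
  · rw [Finset.prod_eq_single 0, Finset.sum_eq_single (x 0), hd0, if_pos, one_mul]
    · funext j
      by_cases hj : j = 0
      · rw [hj, hd0]
      · rw [hx j hj, hd _ j hj]
    · intro z _ hz
      rw [if_neg, zero_mul]
      intro h
      exact hz (by rw [h, hd0])
    · simp
    · intro j _ hj
      rw [hx j hj, hd _ j hj, (hs j hj).1]
    · simp
  · push Not at hx
    obtain ⟨j, hj, hxj⟩ := hx
    rw [Finset.prod_eq_zero (Finset.mem_univ j), Finset.sum_eq_zero]
    · intro z _
      rw [if_neg, zero_mul]
      intro h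
      exact hxj (by rw [h, hd _ j hj])
    · rw [hd _ j hj, Fin.eq_one_of_ne_zero _ hxj, (hs j hj).2]

/-- A Pauli string on the output qubits of a Clifford encoder either acts as a Pauli matrix on
the data qubit, or maps the code space to its orthogonal complement. -/
theorem IsClifford.actsAs_or_eq_zero {V : Matrix (Fin b → Fin 2) (Fin b → Fin 2) ℂ}
    (hV : IsClifford V) (s : Fin b → Pauli) :
    (∃ a, ActsAs (encoder V) s a) ∨
      (encoder V)ᴴ * (tens (fun j => (s j).matrix) * encoder V) = 0 := by
  obtain ⟨s', c, hc, h⟩ := hV.exists_string s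
  have h1 : Vᴴ * V = 1 := Matrix.mem_unitaryGroup_iff'.1 hV.1
  have e : tens (fun j => (s j).matrix) * encoder V =
      c • (V * (tens fun j => (s' j).matrix).submatrix id (dataState b)) := by
    have := congrArg (fun M => M.submatrix id (dataState b)) h
    exact this
  rw [e]
  -- If every ancilla letter of the pulled-back string fixes `|0⟩`, the letter at the data qubit is
  -- the action. Otherwise some ancilla is sent to `|1⟩` up to phase, and all matrix elements
  -- between code states vanish.
  by_cases hs : ∀ j ≠ 0, (s' j).matrix 0 0 = 1 ∧ (s' j).matrix 1 0 = 0
  · refine Or.inl ⟨s' 0, c, hc, ?_⟩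
    have e1 : V * (1 : Matrix (Fin b → Fin 2) (Fin b → Fin 2) ℂ).submatrix id (dataState b) =
        encoder V := by
      conv_rhs => rw [encoder_eq_submatrix, ← Matrix.mul_one V]
      rfl
    rw [e, tens_submatrix_dataState hs, ← Matrix.mul_assoc, e1]
  · right
    push Not at hs
    obtain ⟨j, hj, hsj⟩ := hs
    have h0 : (s' j).matrix 0 0 = 0 :=
      (s' j).matrix_zero_zero.resolve_left fun h => hsj h.1 h.2
    rw [Matrix.mul_smul, encoder_eq_submatrix, Matrix.conjTranspose_submatrix]
    have e2 : Vᴴ.submatrix (dataState b) id *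
        (V * (tens fun j => (s' j).matrix).submatrix id (dataState b)) =
        (Vᴴ * (V * tens fun j => (s' j).matrix)).submatrix (dataState b) (dataState b) := rfl
    rw [e2, ← Matrix.mul_assoc, h1, Matrix.one_mul]
    ext x y
    simp only [Matrix.smul_apply, Matrix.submatrix_apply, tens_apply, Matrix.zero_apply]
    rw [Finset.prod_eq_zero (Finset.mem_univ j), smul_zero]
    simp [dataState, hj, h0]

theorem tens_mul_layer_of_actsAs {U : Unitaries b} {t : ℕ} {s : Level b (t + 1) → Pauli}
    {s' : Level b t → Pauli}
    (h : ∀ v, ActsAs (encoder (U t v)) (childrenEquiv b t Pauli s v) (s' v)) :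
    ∃ c : ℂ, ‖c‖ = 1 ∧ tens (fun u => (s u).matrix) * layer U t =
      c • (layer U t * tens fun v => (s' v).matrix) := by
  choose c hc h using h
  refine ⟨∏ v, c v, by simp [norm_prod, hc], ?_⟩
  rw [tens_mul_layer, layer_mul_tens]
  change Matrix.submatrix (tens fun v => tens (fun j =>
    (childrenEquiv b t Pauli s v j).matrix) * encoder (U t v)) _ _ = _
  simp only [h, tens_smul]
  rfl

/-- If the string at one node sent the code space to its complement, compressing the logical
relation by the isometries would give `c • σ_w = 0`. So each node yields a letter, and cancelling
the last layer shows that these letters are logical one level up. -/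
theorem hasChain_of_isLogical {U : Unitaries b} (hU : ∀ t v, IsClifford (U t v)) {w : Pauli} :
    ∀ {T : ℕ} {s : Level b T → Pauli} {c : ℂ}, ‖c‖ = 1 →
      tens (fun u => (s u).matrix) * concatEncoder U T = c • (concatEncoder U T * w.matrix) →
      HasChain U w (fun _ => True) T s
  | 0, s, c, hc, h => by
    have hc0 : c ≠ 0 := norm_ne_zero_iff.1 (by rw [hc]; norm_num)
    refine string_eq_of_tens_eq_smul hc0 ?_
    rw [concatEncoder, ← tens_mul_rootIso, ← Matrix.smul_mul] at h
    have h' := congrArg (· * (rootIso b)ᴴ) h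
    simpa only [Matrix.mul_assoc, rootIso_mul_conjTranspose, Matrix.mul_one] using h'
  | T + 1, s, c, hc, h => by
    have hW := layer_isometry (t := T) fun v => (hU T v).1
    have hC := concatEncoder_isometry (fun t v => (hU t v).1) T
    have hc0 : c ≠ 0 := norm_ne_zero_iff.1 (by rw [hc]; norm_num)
    rw [concatEncoder, ← Matrix.mul_assoc] at h
    have hv : ∀ v, ∃ a, ActsAs (encoder (U T v)) (childrenEquiv b T Pauli s v) a := by
      intro v
      refine ((hU T v).actsAs_or_eq_zero _).resolve_right fun h0 => ?_
      have h1 : (layer U T)ᴴ * (tens (fun u => (s u).matrix) * layer U T) = 0 := by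
        rw [tens_mul_layer, conjTranspose_layer_mul_submatrix]
        exact tens_eq_zero (i := v) h0
      have h2 := congrArg ((layer U T)ᴴ * ·) h
      simp only [Matrix.mul_smul, ← Matrix.mul_assoc, hW, Matrix.one_mul] at h2 h1
      rw [h1, Matrix.zero_mul] at h2
      have h3 := congrArg ((concatEncoder U T)ᴴ * ·) h2
      simp only [Matrix.mul_smul, ← Matrix.mul_assoc, hC, Matrix.one_mul, Matrix.mul_zero] at h3
      exact smul_ne_zero hc0 w.matrix_ne_zero h3.symm
    choose s' hs' using hv
    refine ⟨fun _ => trivial, s', ?_, hs'⟩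
    obtain ⟨d, hd, hds⟩ := tens_mul_layer_of_actsAs hs'
    have hd0 : d ≠ 0 := norm_ne_zero_iff.1 (by rw [hd]; norm_num)
    refine hasChain_of_isLogical hU (c := d⁻¹ * c) (by rw [norm_mul, norm_inv, hd, hc]; norm_num) ?_
    rw [hds] at h
    have h2 := congrArg ((layer U T)ᴴ * ·) h
    simp only [Matrix.mul_smul, Matrix.smul_mul, ← Matrix.mul_assoc, hW, Matrix.one_mul] at h2
    rw [mul_smul, ← h2, smul_smul, inv_mul_cancel₀ hd0, one_smul]

/-! ### The noisy tree channel -/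

theorem tensorPi_comp_conjBy_pow {ι : Type} [Fintype ι] [DecidableEq ι] (a : ι → Pauli)
    (q : ι → ℝ) (N : SuperOp (Fin 2) (Fin 2)) (R : ι → SuperOp (Fin 2) (Fin 2))
    (hN : ∀ i, N = pauliFlip (a i) (q i) ∘ₗ R i)
    (hR : ∀ i (c : Pauli), R i ∘ₗ conjBy c.matrix = conjBy c.matrix ∘ₗ R i) (y : ι → Bool) :
    tensorPower ι N ∘ₗ conjBy (tens fun i => ((a i).pow (y i)).matrix) =
      (∑ y' : ι → Bool, ((∏ i, bsc (q i) (y i) (y' i) : ℝ) : ℂ) •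
        conjBy (tens fun i => ((a i).pow (y' i)).matrix)) ∘ₗ tensorPi R := by
  rw [tensorPower_eq_tensorPi, ← tensorPi_conjBy, tensorPi_comp]
  have h : ∀ i, N ∘ₗ conjBy ((a i).pow (y i)).matrix =
      (∑ z, (bsc (q i) (y i) z : ℂ) • conjBy ((a i).pow z).matrix) ∘ₗ R i := fun i => by
    rw [← pauliFlip_comp_conj, LinearMap.comp_assoc, ← hR, ← LinearMap.comp_assoc, ← hN]
  simp only [h]
  rw [← tensorPi_comp, tensorPi_sum_smul]
  simp only [tensorPi_conjBy, Complex.ofReal_prod]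

/-- Encoders copy bits: the exponent at a node becomes the exponent at all its children. -/
theorem conjBy_layer_comp_conjBy_pow {U : Unitaries b} {t : ℕ} {s : Level b (t + 1) → Pauli}
    {s' : Level b t → Pauli}
    (h : ∀ v, ActsAs (encoder (U t v)) (childrenEquiv b t Pauli s v) (s' v))
    (y : Level b t → Bool) :
    conjBy (layer U t) ∘ₗ conjBy (tens fun v => ((s' v).pow (y v)).matrix) =
      conjBy (tens fun u => ((s u).pow (y (Fin.init u))).matrix) ∘ₗ conjBy (layer U t) := by
  have h' : ∀ v, ActsAs (encoder (U t v))
      (childrenEquiv b t Pauli (fun u => (s u).pow (y (Fin.init u))) v) ((s' v).pow (y v)) := by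
    intro v
    have e : ∀ j, childrenEquiv b t Pauli (fun u => (s u).pow (y (Fin.init u))) v j =
        (childrenEquiv b t Pauli s v j).pow (y v) := fun j => by
      simp [childrenEquiv_apply]
    simp only [ActsAs, e]
    cases hy : y v
    · refine ⟨1, norm_one, ?_⟩
      simp [Pauli.pow, Pauli.matrix, tens_one]
    · exact h v
  obtain ⟨c, hc, hcs⟩ := tens_mul_layer_of_actsAs h'
  rw [conjBy_comp, conjBy_comp, hcs, conjBy_smul hc]

/-- After the noisy tree channel, a Pauli matrix on the input appears as the result of
broadcasting a bit through the tree, followed by an operator depending on the bits at the leaves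
only. -/
theorem HasChain.exists_broadcast {U : Unitaries b}
    (hU : ∀ t v, U t v ∈ Matrix.unitaryGroup (Fin b → Fin 2) ℂ) {w : Pauli} (hw : w ≠ .I)
    {p : Pauli → ℝ} (h0 : ∀ a, 0 ≤ p a) (h1 : ∀ a, p a ≤ 1) {c : ℝ} (hc : 0 ≤ c)
    {A : Pauli → Prop} (hA : ∀ a, A a → a ≠ .I → (1 - 2 * p a) ^ 2 = c) :
    ∀ {T : ℕ} {s : Level b T → Pauli}, HasChain U w A T s →
      ∃ (P : Bool → (Level b T → Bool) → ℝ) (R : SuperOp (Fin 2) (Level b T → Fin 2)),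
        IsBroadcast (Finset.univ.filter fun u => s u ≠ .I) (c ^ T) P ∧ IsChannel R ∧
        ∀ x, treeChannel U (axisFlips p) T ∘ₗ conjBy (w.pow x).matrix =
          (∑ y, (P x y : ℂ) • conjBy (tens fun u => ((s u).pow (y u)).matrix)) ∘ₗ R
  | 0, s, hs => by
    obtain rfl : s = fun _ => w := hs
    refine ⟨_, conjBy (rootIso b), isBroadcast_root b (by simp [hw]),
      isChannel_conjBy (rootIso_isometry b), fun x => ?_⟩
    rw [Finset.sum_eq_single (fun _ => x)]
    · rw [if_pos rfl, Complex.ofReal_one, one_smul, conjBy_comp, treeChannel, conjBy_comp,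
        tens_mul_rootIso]
    · intro y _ hy
      simp [hy]
    · simp
  | T + 1, s, ⟨hAs, s', hs', hact⟩ => by
    obtain ⟨P, R, hP, hR, h⟩ := exists_broadcast hU hw h0 h1 hc hA hs'
    -- Where the letter is `I`, the bit has no effect and any rate is allowed. Rate `1/2` erases the
    -- information, so such nodes drop out of the count.
    set q : Level b (T + 1) → ℝ := fun u => if s u = .I then 1 / 2 else p (s u) with hq
    have hN : ∀ u, axisFlips p =
        pauliFlip (s u) (q u) ∘ₗ axisFlips (Function.update p (s u) 0) := fun u => by
      rw [axisFlips_eq_pauliFlip_comp (p := p) (a := s u) (Function.update_self _ _ _)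
        fun a ha => Function.update_of_ne ha _ _]
      by_cases hI : s u = .I
      · rw [hI, pauliFlip_I, pauliFlip_I]
      · simp only [hq, if_neg hI]
    refine ⟨_, tensorPi (fun u => axisFlips (Function.update p (s u) 0)) ∘ₗ
      conjBy (layer U T) ∘ₗ R, hP.step (pow_nonneg hc T) (q := q) (d := c) ?_ ?_ ?_,
      IsChannel.comp ?_ (IsChannel.comp (isChannel_conjBy (layer_isometry (hU T))) hR), ?_⟩
    · intro u
      simp only [hq]
      split_ifs
      · norm_num
      · exact h0 _
    · intro u
      simp only [hq]
      split_ifs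
      · norm_num
      · exact h1 _
    · intro u
      by_cases hI : s u = .I
      · simp [hq, hI]
      · simp [hq, hI, hA _ (hAs u) hI]
    · refine isChannel_tensorPi_axisFlips (fun u a => ?_) fun u a => ?_ <;>
        rw [Function.update_apply] <;> split_ifs
      · exact le_rfl
      · exact h0 _
      · exact zero_le_one
      · exact h1 _
    · intro x
      have hy := fun (y : Level b T → Bool) σ => LinearMap.congr_fun (tensorPi_comp_conjBy_pow s q (axisFlips p) _ hN
        (fun u a => axisFlips_comp_conj_comm _ a) fun u => y (Fin.init u)) (conjBy (layer U T) σ)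
      have hy' := fun y σ => LinearMap.congr_fun (conjBy_layer_comp_conjBy_pow hact y) σ
      simp only [LinearMap.comp_apply] at hy hy'
      rw [treeChannel, LinearMap.comp_assoc, LinearMap.comp_assoc, h x]
      refine LinearMap.ext fun ρ => ?_
      simp only [LinearMap.comp_apply, LinearMap.sum_apply, LinearMap.smul_apply, map_sum,
        map_smul, hy', hy, Finset.smul_sum, Complex.ofReal_sum, Complex.ofReal_mul,
        Finset.sum_smul, mul_smul]
      rw [Finset.sum_comm]

/-- The diamond distance between the noisy tree channel and its dephased version. -/
theorem HasChain.sq_diamondNorm_sub_le {U : Unitaries b}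
    (hU : ∀ t v, U t v ∈ Matrix.unitaryGroup (Fin b → Fin 2) ℂ) {w : Pauli} (hw : w ≠ .I)
    {p : Pauli → ℝ} (h0 : ∀ a, 0 ≤ p a) (h1 : ∀ a, p a ≤ 1) {c : ℝ} (hc : 0 ≤ c)
    {A : Pauli → Prop} (hA : ∀ a, A a → a ≠ .I → (1 - 2 * p a) ^ 2 = c) {T : ℕ}
    {L : PauliOp (Level b T)} (hL : HasChain U w A T L.string) :
    diamondNorm (treeChannel U (axisFlips p) T -
      treeChannel U (axisFlips p) T ∘ₗ dephase w) ^ 2 ≤ c ^ T * (L.weight : ℝ) := by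
  obtain ⟨P, R, hP, hR, h⟩ := hL.exists_broadcast hU hw h0 h1 hc hA
  have hf := h false
  have ht := h true
  rw [show w.pow false = .I from rfl, conjBy_I, LinearMap.comp_id] at hf
  rw [show w.pow true = w from rfl] at ht
  have e : treeChannel U (axisFlips p) T - treeChannel U (axisFlips p) T ∘ₗ dephase w =
      ∑ y, (((P false y - P true y) / 2 : ℝ) : ℂ) •
        (conjBy (tens fun u => ((L.string u).pow (y u)).matrix) ∘ₗ R) := by
    have e1 : treeChannel U (axisFlips p) T - treeChannel U (axisFlips p) T ∘ₗ dephase w =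
        (1 / 2 : ℂ) • (treeChannel U (axisFlips p) T -
          treeChannel U (axisFlips p) T ∘ₗ conjBy w.matrix) := by
      rw [dephase, LinearMap.comp_smul, LinearMap.comp_add, LinearMap.comp_id]
      module
    rw [e1, ht, hf, ← LinearMap.sub_comp, ← Finset.sum_sub_distrib, ← LinearMap.smul_comp,
      Finset.smul_sum]
    refine LinearMap.ext fun ρ => ?_
    simp only [LinearMap.comp_apply, LinearMap.sum_apply, LinearMap.smul_apply,
      LinearMap.sub_apply]
    refine Finset.sum_congr rfl fun y _ => ?_
    push_cast
    module
  -- The absolute values of these coefficients sum to the total variation distance.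
  have hle := diamondNorm_sum_smul_le (fun y => (P false y - P true y) / 2)
    fun y : Level b T → Bool => (isChannel_conjBy (tens_matrix_isometry
      fun u => (L.string u).pow (y u))).comp hR
  rw [← e] at hle
  refine (pow_le_pow_left₀ (diamondNorm_nonneg _) hle 2).trans (le_trans (le_of_eq ?_)
    hP.sq_sum_abs_sub_le)
  simp only [abs_div, abs_two, Finset.sum_div]

end QTree

end

theorem mainTheorem4 (b : ℕ) [NeZero b] (U : Unitaries b)
    (hU : ∀ (t : ℕ) (v : Level b t), IsClifford (U t v))
    (T : ℕ) (w : Pauli) (hw : w ≠ Pauli.I)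
    (L : PauliOp (Level b T)) (hL : IsLogical U T w L) :
    (∀ ε : ℝ, 0 ≤ ε → ε ≤ 1 →
      diamondNorm (treeChannel U (depolarizing ε) T -
          treeChannel U (depolarizing ε) T ∘ₗ dephase w) ^ 2 ≤
        2 * (1 - ε) ^ T * (L.weight : ℝ)) ∧
    (w ≠ Pauli.Y → HasYFreeChain U T w L →
      ∀ p : ℝ, 0 ≤ p → p ≤ 1 →
        diamondNorm (treeChannel U (pauliFlip Pauli.Z p ∘ₗ pauliFlip Pauli.X p) T -
            treeChannel U (pauliFlip Pauli.Z p ∘ₗ pauliFlip Pauli.X p) T ∘ₗ dephase w) ^ 2 ≤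
          2 * (1 - 2 * p) ^ (2 * T) * (L.weight : ℝ)) := by
  have hU' : ∀ t v, U t v ∈ Matrix.unitaryGroup (Fin b → Fin 2) ℂ := fun t v => (hU t v).1
  -- The argument gives the bound without the factor 2.
  have two : ∀ {c d : ℝ}, 0 ≤ c → d ≤ c ^ T * (L.weight : ℝ) →
      d ≤ 2 * c ^ T * (L.weight : ℝ) := fun {c d} hc h => by
    have : 0 ≤ c ^ T * (L.weight : ℝ) := by positivity
    linarith
  constructor
  · intro ε h0 h1
    have hs := Real.sq_sqrt (sub_nonneg.2 h1)
    have hs0 := Real.sqrt_nonneg (1 - ε)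
    have hs1 : Real.sqrt (1 - ε) ≤ 1 := Real.sqrt_le_one.2 (by linarith)
    -- The root of `(1 - 2q)² = 1 - ε` that lies in `[0, 1/2]`.
    set q := (1 - Real.sqrt (1 - ε)) / 2 with hq
    have hqε : (1 - 2 * q) ^ 2 = 1 - ε := by
      rw [← hs, hq]
      ring
    rw [depolarizing_eq_axisFlips hqε]
    have hchain : HasChain U w (fun _ => True) T L.string := by
      refine hasChain_of_isLogical hU (c := L.phase⁻¹) (by rw [norm_inv, L.norm_phase, inv_one]) ?_
      have hp : L.phase ≠ 0 := norm_ne_zero_iff.1 (by rw [L.norm_phase]; norm_num)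
      rw [← hL, L.toMatrix_eq, Matrix.smul_mul, smul_smul, inv_mul_cancel₀ hp, one_smul]
    exact two (by linarith) (hchain.sq_diamondNorm_sub_le hU' hw (fun _ => by linarith)
      (fun _ => by linarith) (by linarith) fun _ _ _ => hqε)
  · intro _ hL' p h0 h1
    -- The rate along `Y` is 0, so a letter `Y` would see no contraction; the chain avoids it.
    have hN : pauliFlip Pauli.Z p ∘ₗ pauliFlip Pauli.X p =
        axisFlips fun a => if a = .Y then 0 else p := by
      simp [axisFlips, pauliFlip_zero, pauliFlip_comm .Z .X]
    rw [hN, pow_mul]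
    refine two (sq_nonneg _) ((HasYFreeChain.hasChain hU' hL').sq_diamondNorm_sub_le hU' hw
      (fun a => ?_) (fun a => ?_) (sq_nonneg _) fun a ha _ => ?_)
    · split_ifs <;> linarith
    · split_ifs <;> linarith
    · rw [if_neg ha]
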